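/- Fix integers $m,n\ge 0$ and reals $\lambda,\gamma>0$. Let $\mathbf Q_p$ be the space of real symmetric $p\times p$ matrices and $\mathbf M_{m,n}$ the space of block rows $Y=[Y_0\ \cdots\ Y_n]$ with $Y_j\in\mathbb R^{m\times m}$ and $Y_0$ symmetric. For $Y\in\mathbf M_{m,n}$ let $T(Y)\in\mathbf Q_{m(n+1)}$ be the symmetric block Toeplitz matrix with first block row $Y$. For $X\in\mathbf Q_{m(n+1)}$ with $m\times m$ blocks $X_{ab}$, $0\le a,b\le n$, let $D_0(X)=\sum_{h=0}^n X_{hh}$, $D_j(X)=2\sum_{h=0}^{n-j}X_{h,h+j}$ for $1\le j\le n$, and $D(X)=[D_0(X)\ \cdots\ D_n(X)]$. Put $h_\infty(Y)=\sum_{k>h}\max_{0\le j\le n}\max\{|(Y_j)_{kh}|,|(Y_j)_{hk}|\}$, $\langle A,B\rangle=\operatorname{tr}(AB^T)$ and $\Delta(e^{i\vartheta})=[I_m\ e^{i\vartheta}I_m\ \cdots\ e^{in\vartheta}I_m]$. Let $\mathcal Q_{m,n}$ be the real vector space of functions $\sum_{j=-n}^n e^{-ij\vartheta}R_j$ on the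 unit circle with $R_j=R_{-j}^T\in\mathbb R^{m\times m}$. For $E\subseteq\{1,\dots,m\}^2$ and $G\in\mathbb R^{r\times m(n+1)}$ let $$\mathcal V_E=\{\Sigma\in\mathcal Q_{m,n}:\ \Sigma_{kh}\equiv 0\ \text{for all }(k,h)\notin E\},\qquad \mathcal V_G=\{\Delta G^THG\Delta^*:\ H\in\mathbf Q_r\}.$$ Let $\hat R\in\mathbf M_{m,n}$ with $T(\hat R)\succ0$. Consider the problem $$\text{(P)}\quad \min_{X,L\in\mathbf Q_{m(n+1)}}\ -\log\det X_{00}+\langle T(\hat R),X\rangle+\lambda\gamma\,h_\infty(D(X+L))+\lambda\operatorname{tr}L\quad\text{subject to } X_{00}\succ0,\ X\succeq0,\ L\succeq0,$$ and its dual $$\text{(D)}\quad \max_{W\in\mathbf Q_m,\,Z\in\mathbf M_{m,n}}\ \log\det W+m$$ subject to $W\succ0$, $T(\hat R)+T(Z)\succeq\begin{bmatrix}W&0\\0&0\end{bmatrix}$, $\operatorname{diag}(Z_j)=0$ for $0\le j\le n$, $\sum_{j=0}^n\big(|(Z_j)_{kh}|+|(Z_j)_{hk}|\big)\le\lambda\gamma$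 for $k\ne h$, and $\lambda I+T(Z)\succeq0$. A pair $(\mathcal V_{E_m},\mathcal V_{G'})$ is called a pair of *estimated subspaces* if there are a solution $(X,L)$ of (P) and a full row rank matrix $G'$ with $L=G'^TG'$ such that $E_m$ is the support of $\Delta(X+L)\Delta^*$, i.e. the set of $(k,h)$ whose entry does not vanish identically on the unit circle. Let $(X^\circ,L^\circ)$ be a solution of (P) and $(W^\circ,Z^\circ)$ a solution of (D). Let $l$ be the dimension of the nullspace of $V^\circ=\lambda I+T(Z^\circ)$, let $G\in\mathbb R^{l\times m(n+1)}$ have full row rank with $V^\circ G^T=0$, and let $I=\{(k,h):\ k\ne h,\ \sum_{j=0}^n(|(Z^\circ_j)_{kh}|+|(Z^\circ_j)_{hk}|)<\lambda\gamma\}$. Suppose that the linear system $$(D_j(X^\circ+G^THG))_{kh}=0,\qquad j=0,\dots,n,\ (k,h)\in I,$$ has a unique solution $H\in\mathbf Q_l$. Then there is exactly one pair $(\mathcal V_{E_m},\mathcal V_{G'})$ of estimated subspaces, and it intersects transversally: $\mathcal V_{E_m}\cap\mathcal V_{G'}=\{0\}$. Moreover $\mathcal V_{E_m}\cap\mathcal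 V_{G}=\{0\}$ also for the matrix $G$ above, whose rows span the nullspace of $V^\circ$. -/

import Mathlib

/-! Index conventions: `m` manifest variables, order `n`. A matrix of size `m(n+1)` partitioned into
`m × m` blocks `X_{ab}`, `0 ≤ a, b ≤ n`, is indexed by `Fin (n + 1) × Fin m`, the first component
being the block index. A block row `Y = [Y_0 ⋯ Y_n]` is a function
`Fin (n + 1) → Matrix (Fin m) (Fin m) ℝ`; it belongs to `M_{m,n}` when `Y 0` is symmetric. -/

noncomputable section

namespace LatentAR

/-- Real `m(n+1) × m(n+1)` matrices partitioned into `m × m` blocks. -/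
abbrev BlockMat (m n : ℕ) : Type :=
  Matrix (Fin (n + 1) × Fin m) (Fin (n + 1) × Fin m) ℝ

/-- Block rows `[Y_0 Y_1 ⋯ Y_n]`. -/
abbrev BlockRow (m n : ℕ) : Type :=
  Fin (n + 1) → Matrix (Fin m) (Fin m) ℝ

/-- Matrix valued functions on the unit circle. -/
abbrev CircleFun (m : ℕ) : Type :=
  Circle → Matrix (Fin m) (Fin m) ℂ

/-- The block `X_{ab}`. -/
def block {m n : ℕ} (X : BlockMat m n) (a b : Fin (n + 1)) : Matrix (Fin m) (Fin m) ℝ :=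
  Matrix.of fun k h => X (a, k) (b, h)

/-- The block Toeplitz matrix `T(Y)` with first block row `Y`: the block in position `(a, b)` is
`Y_{b-a}` if `a ≤ b`, and `Y_{a-b}ᵀ` if `a > b`. -/
def toeplitz {m n : ℕ} (Y : BlockRow m n) : BlockMat m n :=
  Matrix.of fun p q =>
    if p.1 ≤ q.1 then
      Y ⟨(q.1 : ℕ) - p.1, lt_of_le_of_lt (Nat.sub_le _ _) q.1.isLt⟩ p.2 q.2
    else
      Y ⟨(p.1 : ℕ) - q.1, lt_of_le_of_lt (Nat.sub_le _ _) p.1.isLt⟩ q.2 p.2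

/-- The map `D`: `D_0(X) = ∑_h X_{hh}` and `D_j(X) = 2 ∑_{h=0}^{n-j} X_{h,h+j}` for `j ≥ 1`. -/
def blockDiagSum {m n : ℕ} (X : BlockMat m n) : BlockRow m n := fun j =>
  (if j = 0 then (1 : ℝ) else 2) •
    ∑ a : Fin (n + 1), ∑ b : Fin (n + 1), if (a : ℕ) + j = b then block X a b else 0

/-- The inner product `⟨A, B⟩ = tr(A Bᵀ)`. -/
def frob {m n : ℕ} (A B : BlockMat m n) : ℝ := (A * B.transpose).trace

/-- The sparsity regularizer `h_∞(Y) = ∑_{k>h} ‖v_{kh}‖_∞`, where `v_{kh}` collects the entries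
`(k,h)` and `(h,k)` of `Y_0, …, Y_n`. -/
def hInf {m n : ℕ} (Y : BlockRow m n) : ℝ :=
  ∑ k : Fin m, ∑ h ∈ Finset.univ.filter (fun h : Fin m => h < k),
    Finset.univ.sup' Finset.univ_nonempty
      (fun j : Fin (n + 1) => max |Y j k h| |Y j h k|)

/-- Feasible set of the regularized primal problem: `X_{00} ≻ 0`, `X ⪰ 0`, `L ⪰ 0`
(`Matrix.PosDef` and `Matrix.PosSemidef` contain symmetry). -/
def PrimalFeasible {m n : ℕ} (X L : BlockMat m n) : Prop :=
  (block X 0 0).PosDef ∧ X.PosSemidef ∧ L.PosSemidef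

/-- Objective of the regularized primal problem. -/
def primalObj {m n : ℕ} (R : BlockRow m n) (lam gam : ℝ) (X L : BlockMat m n) : ℝ :=
  -Real.log (block X 0 0).det + frob (toeplitz R) X
    + lam * gam * hInf (blockDiagSum (X + L)) + lam * L.trace

/-- `(X, L)` solves the regularized primal problem. -/
def IsPrimalSolution {m n : ℕ} (R : BlockRow m n) (lam gam : ℝ) (X L : BlockMat m n) : Prop :=
  PrimalFeasible X L ∧
    ∀ X' L' : BlockMat m n, PrimalFeasible X' L' →
      primalObj R lam gam X L ≤ primalObj R lam gam X' L'

/-- The matrix with block `W` in position `(0, 0)` and zero blocks elsewhere. -/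
def embed00 {m : ℕ} (n : ℕ) (W : Matrix (Fin m) (Fin m) ℝ) : BlockMat m n :=
  Matrix.of fun p q => if p.1 = 0 ∧ q.1 = 0 then W p.2 q.2 else 0

/-- `V = lam I + T(Z)`. -/
def slackV {m n : ℕ} (lam : ℝ) (Z : BlockRow m n) : BlockMat m n :=
  lam • (1 : BlockMat m n) + toeplitz Z

/-- Feasible set of the dual problem. -/
def DualFeasible {m n : ℕ} (R : BlockRow m n) (lam gam : ℝ)
    (W : Matrix (Fin m) (Fin m) ℝ) (Z : BlockRow m n) : Prop :=
  W.PosDef ∧ (Z 0).IsSymm ∧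
  (toeplitz R + toeplitz Z - embed00 n W).PosSemidef ∧
  (∀ j k, Z j k k = 0) ∧
  (∀ k h, k ≠ h → ∑ j, (|Z j k h| + |Z j h k|) ≤ lam * gam) ∧
  (slackV lam Z).PosSemidef

/-- `(W, Z)` solves the dual problem, i.e. maximizes `log det W + m` over the feasible set. -/
def IsDualSolution {m n : ℕ} (R : BlockRow m n) (lam gam : ℝ)
    (W : Matrix (Fin m) (Fin m) ℝ) (Z : BlockRow m n) : Prop :=
  DualFeasible R lam gam W Z ∧
    ∀ (W' : Matrix (Fin m) (Fin m) ℝ) (Z' : BlockRow m n), DualFeasible R lam gam W' Z' →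
      Real.log W'.det + (m : ℝ) ≤ Real.log W.det + (m : ℝ)

/-- The rows of `G` form a basis of the nullspace of `V`: `G` is an `l × m(n+1)` matrix of full row
rank with `V Gᵀ = 0`, where `l` is the dimension of the nullspace of `V`. -/
def IsNullBasis {m n l : ℕ} (V : BlockMat m n)
    (G : Matrix (Fin l) (Fin (n + 1) × Fin m) ℝ) : Prop :=
  l = Module.finrank ℝ (LinearMap.ker V.mulVecLin) ∧ G.rank = l ∧ V * G.transpose = 0

/-- The index set `I` of the pairs at which the dual constraint is inactive. -/
def inactivePairs {m n : ℕ} (lam gam : ℝ) (Z : BlockRow m n) : Set (Fin m × Fin m) :=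
  {p | p.1 ≠ p.2 ∧ ∑ j, (|Z j p.1 p.2| + |Z j p.2 p.1|) < lam * gam}

/-- The symmetric matrix `H` solves the linear system `(D_j(X + Gᵀ H G))_{kh} = 0`,
`j = 0, …, n`, `(k, h) ∈ I`. -/
def SolvesScalingSystem {m n l : ℕ} (lam gam : ℝ) (X : BlockMat m n) (Z : BlockRow m n)
    (G : Matrix (Fin l) (Fin (n + 1) × Fin m) ℝ) (H : Matrix (Fin l) (Fin l) ℝ) : Prop :=
  H.IsSymm ∧ ∀ j, ∀ p ∈ inactivePairs lam gam Z,
    blockDiagSum (X + G.transpose * H * G) j p.1 p.2 = 0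

/-- The shift operator `Δ(z) = [I  z I  ⋯  z^n I]`, `z = e^{iϑ}`. -/
def shiftOp (m n : ℕ) (z : Circle) : Matrix (Fin m) (Fin (n + 1) × Fin m) ℂ :=
  Matrix.of fun k p => if k = p.2 then (z : ℂ) ^ (p.1 : ℕ) else 0

/-- The function `Δ X Δ^*` on the unit circle. -/
def symbol {m n : ℕ} (X : BlockMat m n) : CircleFun m := fun z =>
  shiftOp m n z * X.map (algebraMap ℝ ℂ) * (shiftOp m n z).conjTranspose

/-- The function `∑_{j=-n}^{n} e^{-ijϑ} R_j` on the unit circle. -/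
def pseudoPoly {m : ℕ} (n : ℕ) (R : ℤ → Matrix (Fin m) (Fin m) ℝ) : CircleFun m := fun z =>
  ∑ j ∈ Finset.Icc (-(n : ℤ)) (n : ℤ), ((z : ℂ) ^ (-j)) • (R j).map (algebraMap ℝ ℂ)

/-- The real vector space `Q_{m,n}` of matrix pseudo-polynomials `∑_{j=-n}^{n} e^{-ijϑ} R_j` with
real coefficients such that `R_j = R_{-j}ᵀ`. -/
def pseudoPolySpace (m n : ℕ) : Submodule ℝ (CircleFun m) where
  carrier := {Φ | ∃ R : ℤ → Matrix (Fin m) (Fin m) ℝ,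
    (∀ j, R j = (R (-j)).transpose) ∧ Φ = pseudoPoly n R}
  zero_mem' := by
    refine ⟨0, fun j => by simp, ?_⟩
    funext z
    ext k h
    simp [pseudoPoly, Matrix.sum_apply]
  add_mem' := by
    rintro _ _ ⟨R, hR, rfl⟩ ⟨S, hS, rfl⟩
    refine ⟨R + S, fun j => ?_, ?_⟩
    · rw [Pi.add_apply, Pi.add_apply, Matrix.transpose_add, ← hR, ← hS]
    · funext z
      ext k h
      simp [pseudoPoly, Matrix.sum_apply, mul_add, Finset.sum_add_distrib]
  smul_mem' := by
    rintro c _ ⟨R, hR, rfl⟩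
    refine ⟨c • R, fun j => ?_, ?_⟩
    · rw [Pi.smul_apply, Pi.smul_apply, Matrix.transpose_smul, ← hR]
    · funext z
      ext k h
      simp [pseudoPoly, Matrix.sum_apply, Finset.mul_sum, mul_left_comm]

/-- The support of a matrix valued function: the entries that do not vanish identically. -/
def support {m : ℕ} (Φ : CircleFun m) : Set (Fin m × Fin m) :=
  {p | ∃ z, Φ z p.1 p.2 ≠ 0}

/-- The subspace `V_E` of the elements of `Q_{m,n}` whose entries outside `E` vanish. -/
def sparseSpace {m : ℕ} (n : ℕ) (E : Set (Fin m × Fin m)) : Submodule ℝ (CircleFun m) where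
  carrier := {Φ | Φ ∈ pseudoPolySpace m n ∧ ∀ p ∈ Eᶜ, ∀ z, Φ z p.1 p.2 = 0}
  zero_mem' := ⟨Submodule.zero_mem _, fun _ _ _ => rfl⟩
  add_mem' := by
    rintro Φ Ψ ⟨h1, h2⟩ ⟨h3, h4⟩
    refine ⟨Submodule.add_mem _ h1 h3, fun p hp z => ?_⟩
    simp [h2 p hp z, h4 p hp z]
  smul_mem' := by
    rintro c Φ ⟨h1, h2⟩
    refine ⟨Submodule.smul_mem _ c h1, fun p hp z => ?_⟩
    simp [h2 p hp z]

/-- The subspace `V_G = {Δ Gᵀ H G Δ^* : H symmetric}`. -/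
def lowRankSpace {m n l : ℕ} (G : Matrix (Fin l) (Fin (n + 1) × Fin m) ℝ) :
    Submodule ℝ (CircleFun m) where
  carrier := {Φ | ∃ H : Matrix (Fin l) (Fin l) ℝ,
    H.IsSymm ∧ Φ = symbol (G.transpose * H * G)}
  zero_mem' := by
    refine ⟨0, Matrix.isSymm_zero, ?_⟩
    funext z
    simp [symbol]
  add_mem' := by
    rintro _ _ ⟨H, hH, rfl⟩ ⟨K, hK, rfl⟩
    refine ⟨H + K, hH.add hK, ?_⟩
    funext z
    simp [symbol, Matrix.mul_add, Matrix.add_mul, Matrix.map_add]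
  smul_mem' := by
    rintro c _ ⟨H, hH, rfl⟩
    refine ⟨c • H, hH.smul c, ?_⟩
    have hmap : ∀ A : BlockMat m n,
        (c • A).map (algebraMap ℝ ℂ) = c • A.map (algebraMap ℝ ℂ) := by
      intro A
      ext p q
      simp
    funext z
    simp only [symbol, Pi.smul_apply, Matrix.mul_smul, Matrix.smul_mul, hmap]

/-- `(VE, VG)` is a pair of subspaces estimated from a solution `(X, L)` of the regularized
problem: `VE = V_E` with `E` the support of `Δ (X + L) Δ^*`, and `VG = V_G` with `L = Gᵀ G` and `G`
of full row rank. -/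
def IsEstimatedPair {m n : ℕ} (R : BlockRow m n) (lam gam : ℝ)
    (VE VG : Submodule ℝ (CircleFun m)) : Prop :=
  ∃ (X L : BlockMat m n) (r : ℕ) (G : Matrix (Fin r) (Fin (n + 1) × Fin m) ℝ),
    IsPrimalSolution R lam gam X L ∧ L = G.transpose * G ∧ G.rank = r ∧
    VE = sparseSpace n (support (symbol (X + L))) ∧ VG = lowRankSpace G

end LatentAR

end

/-! The argument fixes the dual solution `(W, Z)` and tests every primal solution `(X', L')` against
it. Once the duality gap is zero (`primalObj_le_dual`), `complementary_slackness` gives `X'_{00} =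
W⁻¹`, `(A - embed00 n W) X' = 0` with `A = T(R) + T(Z)`, `V L' = 0` with `V = lam I + T(Z)`, and
`D(X' + L') = 0` at the inactive pairs.

These relations determine the primal solution. The Toeplitz structure upgrades dual feasibility to
`A ≻ 0` (`toeplitz_posDef`), so `X'` is an explicit function of `A` and `W` (`eq_of_slackness`). The
columns of `L'` lie in the nullspace of `V`, so `L' = Gᵀ H G`, and `H` solves the linear system; its
unique solvability fixes `L'`. Full row rank factors of the same matrix have the same row space, so
the estimated pair is unique too.

For transversality, let the symbol of `Gᵀ K G` lie in `V_E`. The inactive pairs are outside `E`, so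
`D(Gᵀ K G)` vanishes there and `H + K` solves the system along with `H`; hence `K = 0`. The
estimated low rank space lies inside `V_G`, so it inherits this.

For the zero gap, perturbing the argument of `h_∞` makes the value function convex with open strict
epigraph, and Hahn–Banach yields a multiplier `Z₁`. It only makes `T(R) + T(Z₁)` semidefinite, so a
dual feasible `W` may be missing; shrinking to `(1 - t) Z₁` restores definiteness, and `t` is then
taken small. -/

open Matrix

namespace LatentAR

/-! ### Factorizations, trace and log-determinant inequalities for real matrices. -/

section MatrixLemmas

open scoped MatrixOrder

variable {ι : Type*} [Fintype ι]

theorem exists_eq_transpose_mul_self {A : Matrix ι ι ℝ} (hA : A.PosSemidef) :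
    ∃ B : Matrix ι ι ℝ, A = Bᵀ * B := by
  classical
  obtain ⟨B, hB⟩ := CStarAlgebra.nonneg_iff_eq_star_mul_self.mp hA.nonneg
  exact ⟨B, by simpa [star_eq_conjTranspose] using hB⟩

/-- Rows scaled by `√` of the nonzero eigenvalues only: discarding the zero ones is what gives full
row rank. -/
theorem exists_full_rank_factor {A : Matrix ι ι ℝ} (hA : A.PosSemidef) :
    ∃ (r : ℕ) (G : Matrix (Fin r) ι ℝ), A = Gᵀ * G ∧ G.rank = r := by
  classical
  set d := hA.1.eigenvalues with hd
  set U : Matrix ι ι ℝ := (hA.1.eigenvectorUnitary : Matrix ι ι ℝ) with hU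
  let e := (Fintype.equivFin {i // d i ≠ 0}).symm
  let G : Matrix (Fin (Fintype.card {i // d i ≠ 0})) ι ℝ :=
    Matrix.of fun i p => √(d (e i)) * U p (e i)
  have hfac : A = Gᵀ * G := by
    have hs : A = U * diagonal d * Uᵀ := by
      have := hA.1.spectral_theorem
      rw [Unitary.conjStarAlgAut_apply] at this
      simpa [star_eq_conjTranspose, Function.comp_def] using this
    ext p q
    have h1 : A p q = ∑ i, d i * (U p i * U q i) := by
      conv_lhs => rw [hs]
      rw [mul_apply]
      simp only [mul_diagonal, transpose_apply]
      exact Finset.sum_congr rfl fun i _ => by ring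
    have h2 : (Gᵀ * G) p q = ∑ i, d (e i) * (U p (e i) * U q (e i)) := by
      simp only [mul_apply, transpose_apply, G, of_apply]
      refine Finset.sum_congr rfl fun i _ => ?_
      have := Real.mul_self_sqrt (hA.eigenvalues_nonneg (e i))
      linear_combination (U p (e i) * U q (e i)) * this
    rw [h1, h2, Equiv.sum_comp e (fun i => d i * (U p i * U q i)),
      ← Finset.sum_subtype (Finset.univ.filter (d · ≠ 0)) (by simp)
        (fun i => d i * (U p i * U q i))]
    refine (Finset.sum_filter_of_ne (p := fun i => d i ≠ 0) fun i _ h hi => h ?_).symm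
    rw [hi, zero_mul]
  refine ⟨_, G, hfac, ?_⟩
  rw [← rank_transpose_mul_self, ← hfac, hA.1.rank_eq_card_non_zero_eigs]

theorem isUnit_mul_transpose_of_rank {r : ℕ} {G : Matrix (Fin r) ι ℝ} (hG : G.rank = r) :
    IsUnit (G * Gᵀ).det := by
  classical
  have h : (G * Gᵀ).rank = r := by rw [rank_self_mul_transpose, hG]
  have hs : Function.Surjective (G * Gᵀ).mulVecLin := by
    rw [← LinearMap.range_eq_top]
    apply Submodule.eq_top_of_finrank_eq
    simpa [Matrix.rank] using h
  have hu : IsUnit (G * Gᵀ) := by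
    rw [← mulVec_surjective_iff_isUnit]
    exact hs
  exact (isUnit_iff_isUnit_det _).mp hu

/-- With `A = Cᵀ C` and `B = Dᵀ D`, the trace is the squared Frobenius norm of `D Cᵀ`. -/
theorem mul_eq_zero_of_trace_mul_eq_zero {A B : Matrix ι ι ℝ} (hA : A.PosSemidef)
    (hB : B.PosSemidef) : 0 ≤ (A * B).trace ∧ ((A * B).trace = 0 → A * B = 0) := by
  obtain ⟨C, rfl⟩ := exists_eq_transpose_mul_self hA
  obtain ⟨D, rfl⟩ := exists_eq_transpose_mul_self hB
  have key : (Cᵀ * C * (Dᵀ * D)).trace = ((D * Cᵀ)ᴴ * (D * Cᵀ)).trace := by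
    rw [trace_mul_comm (D * Cᵀ)ᴴ]
    simp only [conjTranspose_eq_transpose_of_trivial, transpose_mul, transpose_transpose]
    rw [← Matrix.mul_assoc, trace_mul_comm]
    simp only [Matrix.mul_assoc]
  rw [key]
  refine ⟨(posSemidef_conjTranspose_mul_self _).trace_nonneg, fun h => ?_⟩
  have h0 := trace_conjTranspose_mul_self_eq_zero_iff.mp h
  have h1 : C * Dᵀ = 0 := by
    rw [← transpose_transpose (C * Dᵀ), transpose_mul, transpose_transpose, h0, transpose_zero]
  rw [Matrix.mul_assoc, ← Matrix.mul_assoc C, h1]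
  simp

/-- This is `log x ≤ x - 1` summed over the eigenvalues; equality forces each eigenvalue to be `1`.
-/
theorem log_det_add_card_le_trace [DecidableEq ι] {S : Matrix ι ι ℝ} (hS : S.PosDef) :
    Real.log S.det + Fintype.card ι ≤ S.trace ∧
      (S.trace ≤ Real.log S.det + Fintype.card ι → S = 1) := by
  set d := hS.1.eigenvalues with hd
  have hpos : ∀ i, 0 < d i := hS.eigenvalues_pos
  have htr : S.trace = ∑ i, d i := by simpa using hS.1.trace_eq_sum_eigenvalues
  have hdet : Real.log S.det = ∑ i, Real.log (d i) := by
    rw [hS.1.det_eq_prod_eigenvalues]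
    simpa using Real.log_prod (s := Finset.univ) (f := d) (fun i _ => (hpos i).ne')
  have hcard : (Fintype.card ι : ℝ) = ∑ _i : ι, (1 : ℝ) := by simp
  have hle : ∀ i ∈ Finset.univ, Real.log (d i) + 1 ≤ d i := fun i _ => by
    linarith [Real.log_le_sub_one_of_pos (hpos i)]
  rw [htr, hdet, hcard, ← Finset.sum_add_distrib]
  refine ⟨Finset.sum_le_sum hle, fun h => ?_⟩
  have heq := (Finset.sum_eq_sum_iff_of_le hle).mp (le_antisymm (Finset.sum_le_sum hle) h)
  have h1 : d = fun _ => 1 := by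
    funext i
    by_contra hi
    linarith [Real.log_lt_sub_one_of_pos (hpos i) hi, heq i (Finset.mem_univ i)]
  have hs := hS.1.spectral_theorem
  rw [← hd, h1] at hs
  rw [hs]
  simp

/-- The Fenchel inequality for `-log det`, with its equality case: factor `W = Bᵀ B` and apply the
previous bound to `B X Bᵀ`. -/
theorem log_det_add_log_det_add_card_le [DecidableEq ι] {W X : Matrix ι ι ℝ} (hW : W.PosDef)
    (hX : X.PosDef) :
    Real.log W.det + Fintype.card ι ≤ -Real.log X.det + (W * X).trace ∧
      (-Real.log X.det + (W * X).trace ≤ Real.log W.det + Fintype.card ι → X = W⁻¹) := by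
  obtain ⟨B, rfl⟩ := exists_eq_transpose_mul_self hW.posSemidef
  have hdB : B.det ≠ 0 := fun h => by simpa [h] using hW.det_pos
  have hinj : Function.Injective (fun v => v ᵥ* B) :=
    vecMul_injective_iff_isUnit.mpr ((isUnit_iff_isUnit_det _).mpr hdB.isUnit)
  have hS : (B * X * Bᵀ).PosDef := by
    simpa using hX.mul_mul_conjTranspose_same (B := B) hinj
  have htr : (B * X * Bᵀ).trace = (Bᵀ * B * X).trace := by
    rw [trace_mul_comm, ← Matrix.mul_assoc]
  have hdet : Real.log (B * X * Bᵀ).det = Real.log (Bᵀ * B).det + Real.log X.det := by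
    rw [← Real.log_mul hW.det_pos.ne' hX.det_pos.ne']
    congr 1
    simp only [det_mul, det_transpose]
    ring
  obtain ⟨h1, h2⟩ := log_det_add_card_le_trace hS
  rw [htr, hdet] at h1 h2
  refine ⟨by linarith, fun h => ?_⟩
  have h3 := h2 (by linarith)
  refine (inv_eq_left_inv ?_).symm
  have h4 : B * (X * Bᵀ) = 1 := by rw [← h3, Matrix.mul_assoc]
  rw [← Matrix.mul_assoc]
  exact mul_eq_one_comm.mp h4

end MatrixLemmas

/-! ### The Toeplitz map, the map `D` and their adjointness. -/

variable {m n : ℕ}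

theorem toeplitz_isSymm {Y : BlockRow m n} (hY : (Y 0).IsSymm) : (toeplitz Y).IsSymm := by
  ext ⟨a, k⟩ ⟨b, h⟩
  simp only [toeplitz, transpose_apply, of_apply]
  rcases lt_trichotomy a b with hab | rfl | hab
  · simp [hab.le, not_le.mpr hab]
  · have : (⟨(a : ℕ) - a, lt_of_le_of_lt (Nat.sub_le _ _) a.isLt⟩ : Fin (n + 1)) = 0 := by
      ext; simp
    simp only [le_refl, if_true, this]
    exact hY.apply k h
  · simp [hab.le, not_le.mpr hab]

/-- A pair `(a, b)` meets the condition `a + j = b` for exactly one `j` when `a ≤ b`, and for none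
otherwise. -/
theorem sum_shift {M : Type*} [AddCommMonoid M]
    (F : Fin (n + 1) → Fin (n + 1) → Fin (n + 1) → M) :
    ∑ j : Fin (n + 1), ∑ a : Fin (n + 1), ∑ b : Fin (n + 1),
        (if (a : ℕ) + j = b then F j a b else 0) =
      ∑ a : Fin (n + 1), ∑ b : Fin (n + 1),
        if a ≤ b then F ⟨(b : ℕ) - a, lt_of_le_of_lt (Nat.sub_le _ _) b.isLt⟩ a b else 0 := by
  rw [Finset.sum_comm]
  refine Finset.sum_congr rfl fun a _ => ?_
  rw [Finset.sum_comm]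
  refine Finset.sum_congr rfl fun b _ => ?_
  split_ifs with hab
  · rw [Finset.sum_eq_single ⟨(b : ℕ) - a, lt_of_le_of_lt (Nat.sub_le _ _) b.isLt⟩]
    · rw [if_pos]
      simp only
      have : (a : ℕ) ≤ b := hab
      omega
    · intro j _ hj
      rw [if_neg]
      intro h
      apply hj
      ext
      simp only
      omega
    · simp
  · refine Finset.sum_eq_zero fun j _ => if_neg fun h => hab ?_
    have : (a : ℕ) ≤ b := by omega
    exact this

theorem sum_sum_comm {ι κ M : Type*} [Fintype ι] [Fintype κ] [AddCommMonoid M]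
    (f : κ → κ → ι → ι → M) :
    ∑ k, ∑ h, ∑ a, ∑ b, f k h a b = ∑ a, ∑ b, ∑ k, ∑ h, f k h a b := by
  calc _ = ∑ p : κ × κ, ∑ q : ι × ι, f p.1 p.2 q.1 q.2 := by simp only [Fintype.sum_prod_type]
    _ = ∑ q : ι × ι, ∑ p : κ × κ, f p.1 p.2 q.1 q.2 := Finset.sum_comm
    _ = _ := by simp only [Fintype.sum_prod_type]

theorem sum_sum_eq_sum_sum_lt {ι M : Type*} [Fintype ι] [LinearOrder ι] [AddCommMonoid M]
    (f : ι → ι → M) (hf : ∀ k, f k k = 0) :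
    ∑ k, ∑ h, f k h = ∑ k, ∑ h ∈ Finset.univ.filter (fun h => h < k), (f k h + f h k) := by
  have h1 : ∀ k, ∑ h, f k h = (∑ h, if h < k then f k h else 0) +
      ∑ h, if k < h then f k h else 0 := by
    intro k
    rw [← Finset.sum_add_distrib]
    refine Finset.sum_congr rfl fun h _ => ?_
    rcases lt_trichotomy h k with hk | rfl | hk
    · simp [hk, hk.not_gt]
    · simp [hf]
    · simp [hk, hk.not_gt]
  simp only [Finset.sum_add_distrib, Finset.sum_filter, h1]
  congr 1
  rw [Finset.sum_comm]

theorem blockDiagSum_apply (X : BlockMat m n) (j : Fin (n + 1)) (k h : Fin m) :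
    blockDiagSum X j k h = (if j = 0 then (1 : ℝ) else 2) *
      ∑ a : Fin (n + 1), ∑ b : Fin (n + 1), if (a : ℕ) + j = b then X (a, k) (b, h) else 0 := by
  simp only [blockDiagSum, Matrix.smul_apply, Matrix.sum_apply, smul_eq_mul]
  congr 1
  refine Finset.sum_congr rfl fun a _ => Finset.sum_congr rfl fun b _ => ?_
  split_ifs <;> simp [block]

theorem blockDiagSum_add (X Y : BlockMat m n) :
    blockDiagSum (X + Y) = blockDiagSum X + blockDiagSum Y := by
  funext j
  ext k h
  rw [Pi.add_apply, Matrix.add_apply]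
  simp only [blockDiagSum_apply, ← mul_add, ← Finset.sum_add_distrib]
  congr 1
  refine Finset.sum_congr rfl fun a _ => Finset.sum_congr rfl fun b _ => ?_
  split_ifs <;> simp

theorem blockDiagSum_smul (c : ℝ) (X : BlockMat m n) :
    blockDiagSum (c • X) = c • blockDiagSum X := by
  funext j
  ext k h
  rw [Pi.smul_apply, Matrix.smul_apply]
  rw [blockDiagSum_apply, blockDiagSum_apply, smul_eq_mul, mul_left_comm]
  congr 1
  simp only [Finset.mul_sum]
  refine Finset.sum_congr rfl fun a _ => Finset.sum_congr rfl fun b _ => ?_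
  split_ifs <;> simp

theorem blockDiagSum_zero_symm {X : BlockMat m n} (hX : X.IsSymm) (k h : Fin m) :
    blockDiagSum X 0 k h = blockDiagSum X 0 h k := by
  simp only [blockDiagSum_apply]
  congr 1
  refine Finset.sum_congr rfl fun a _ => Finset.sum_congr rfl fun b _ => ?_
  split_ifs with hab
  · have : a = b := by ext; simpa using hab
    subst this
    exact hX.apply _ _
  · rfl

/-- The pairing `∑_j tr(Z_j Y_jᵀ)` of block rows. -/
def pairing (Z Y : BlockRow m n) : ℝ := ∑ j, ∑ k, ∑ h, Z j k h * Y j k h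

theorem frob_eq_sum (A B : BlockMat m n) : frob A B = ∑ p, ∑ q, A p q * B p q := by
  simp [frob, trace, mul_apply]

/-- On symmetric matrices `D` is the adjoint of `T`: by symmetry the blocks below the diagonal
repeat those above it, which is the factor `2` in `D_j`, `j ≥ 1`. -/
theorem frob_toeplitz (Z : BlockRow m n) {X : BlockMat m n} (hX : X.IsSymm) :
    frob (toeplitz Z) X = pairing Z (blockDiagSum X) := by
  let s : Fin (n + 1) → Fin (n + 1) → Fin (n + 1) := fun a b =>
    ⟨(b : ℕ) - a, lt_of_le_of_lt (Nat.sub_le _ _) b.isLt⟩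
  let P : Fin (n + 1) → Fin (n + 1) → Fin (n + 1) → ℝ := fun j a b =>
    ∑ k, ∑ h, Z j k h * X (a, k) (b, h)
  have hL : frob (toeplitz Z) X =
      ∑ a, ∑ b, if a ≤ b then P (s a b) a b else P (s b a) b a := by
    rw [frob_eq_sum]
    simp only [Fintype.sum_prod_type]
    refine Finset.sum_congr rfl fun a _ => ?_
    rw [Finset.sum_comm]
    refine Finset.sum_congr rfl fun b _ => ?_
    split_ifs with hab
    · simp [toeplitz, hab, P, s]
    · simp only [toeplitz, hab, P, s, of_apply, if_false]
      rw [Finset.sum_comm]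
      refine Finset.sum_congr rfl fun h _ => Finset.sum_congr rfl fun k _ => ?_
      rw [hX.apply (b, h) (a, k)]
  have hR : pairing Z (blockDiagSum X) = ∑ j : Fin (n + 1), ∑ a : Fin (n + 1), ∑ b : Fin (n + 1),
      if (a : ℕ) + j = b then (if j = 0 then (1 : ℝ) else 2) * P j a b else 0 := by
    refine Finset.sum_congr rfl fun j _ => ?_
    simp only [blockDiagSum_apply, Finset.mul_sum, P]
    rw [sum_sum_comm]
    refine Finset.sum_congr rfl fun a _ => Finset.sum_congr rfl fun b _ => ?_
    by_cases hab : (a : ℕ) + j = b <;> simp [hab, mul_left_comm]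
  rw [hL, hR, sum_shift (fun j a b => (if j = 0 then (1 : ℝ) else 2) * P j a b)]
  have h1 : (∑ a, ∑ b, if a ≤ b then P (s a b) a b else P (s b a) b a) =
      (∑ a, ∑ b, if a ≤ b then P (s a b) a b else 0) +
      ∑ a, ∑ b, if a < b then P (s a b) a b else 0 := by
    rw [Finset.sum_comm (f := fun a b => if a < b then P (s a b) a b else 0)]
    simp only [← Finset.sum_add_distrib]
    refine Finset.sum_congr rfl fun a _ => Finset.sum_congr rfl fun b _ => ?_
    by_cases hab : a ≤ b
    · simp [hab, hab.not_gt]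
    · simp [hab, not_le.mp hab]
  rw [h1]
  simp only [← Finset.sum_add_distrib]
  refine Finset.sum_congr rfl fun a _ => Finset.sum_congr rfl fun b _ => ?_
  rcases lt_trichotomy a b with hab | rfl | hab
  · have h0 : s a b ≠ 0 := by
      intro h
      have := congrArg Fin.val h
      simp only [s, Fin.val_zero] at this
      have : (a : ℕ) < b := hab
      omega
    simp only [s] at h0
    simp [hab, hab.le, h0, s, two_mul]
  · have h0 : s a a = 0 := by ext; simp [s]
    simp only [s] at h0
    simp [s, h0]
  · simp [hab.not_gt, hab.not_ge]

theorem frob_add_left (A B C : BlockMat m n) : frob (A + B) C = frob A C + frob B C := by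
  simp [frob, add_mul]

theorem frob_add_right (A B C : BlockMat m n) : frob A (B + C) = frob A B + frob A C := by
  simp [frob, mul_add]

theorem frob_smul_left (c : ℝ) (A B : BlockMat m n) : frob (c • A) B = c * frob A B := by
  simp [frob]

theorem frob_smul_right (c : ℝ) (A B : BlockMat m n) : frob A (c • B) = c * frob A B := by
  simp [frob]

/-! ### The first block and positive definiteness of Toeplitz matrices. -/

/-- The inclusion of the first block coordinate. -/
def firstBlock (m n : ℕ) : Matrix (Fin (n + 1) × Fin m) (Fin m) ℝ :=
  Matrix.of fun p k => if p.1 = 0 ∧ p.2 = k then 1 else 0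

theorem mul_firstBlock {κ : Type*} (B : Matrix κ (Fin (n + 1) × Fin m) ℝ) (i : κ) (k : Fin m) :
    (B * firstBlock m n) i k = B i (0, k) := by
  rw [mul_apply, Finset.sum_eq_single (0, k)]
  · simp [firstBlock]
  · rintro ⟨a, h⟩ _ hne
    simp only [firstBlock, of_apply]
    rw [if_neg, mul_zero]
    rintro ⟨rfl, rfl⟩
    exact hne rfl
  · simp

theorem transpose_firstBlock_mul {κ : Type*} (B : Matrix (Fin (n + 1) × Fin m) κ ℝ) (k : Fin m)
    (i : κ) : ((firstBlock m n)ᵀ * B) k i = B (0, k) i := by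
  rw [← transpose_apply (_ * _), transpose_mul, transpose_transpose, mul_firstBlock,
    transpose_apply]

theorem block_zero_zero (X : BlockMat m n) :
    block X 0 0 = (firstBlock m n)ᵀ * X * firstBlock m n := by
  ext k h
  rw [mul_firstBlock, transpose_firstBlock_mul]
  rfl

theorem embed00_eq (W : Matrix (Fin m) (Fin m) ℝ) :
    embed00 n W = firstBlock m n * W * (firstBlock m n)ᵀ := by
  ext ⟨a, k⟩ ⟨b, h⟩
  simp only [mul_apply, firstBlock, transpose_apply, of_apply, embed00]
  by_cases ha : a = 0 <;> by_cases hb : b = 0 <;> simp [ha, hb]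

theorem frob_embed00 (W : Matrix (Fin m) (Fin m) ℝ) {X : BlockMat m n} (hX : X.IsSymm) :
    frob (embed00 n W) X = (W * block X 0 0).trace := by
  rw [frob, hX.eq, embed00_eq, block_zero_zero]
  simp only [Matrix.mul_assoc]
  rw [trace_mul_comm]
  simp only [Matrix.mul_assoc]

theorem embed00_posSemidef {W : Matrix (Fin m) (Fin m) ℝ} (hW : W.PosSemidef) :
    (embed00 n W).PosSemidef := by
  rw [embed00_eq]
  simpa using hW.mul_mul_conjTranspose_same (firstBlock m n)

/-- Here `w` is `v` with its zero first block dropped and a zero block appended; a Toeplitz form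
does not see the shift. -/
theorem dotProduct_toeplitz_mulVec (Y : BlockRow m n) (v w : Fin (n + 1) × Fin m → ℝ)
    (hv : ∀ k, v (0, k) = 0) (hs : ∀ (a : Fin n) k, w (a.castSucc, k) = v (a.succ, k))
    (hw : ∀ k, w (Fin.last n, k) = 0) :
    w ⬝ᵥ (toeplitz Y *ᵥ w) = v ⬝ᵥ (toeplitz Y *ᵥ v) := by
  have hT : ∀ (a b : Fin n) k h, toeplitz Y (a.castSucc, k) (b.castSucc, h) =
      toeplitz Y (a.succ, k) (b.succ, h) := by
    intro a b k h
    simp [toeplitz]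
  simp only [dotProduct, mulVec, Fintype.sum_prod_type]
  rw [Fin.sum_univ_castSucc, Fin.sum_univ_succ]
  simp only [Fin.sum_univ_castSucc (n := n) (f := fun b => ∑ h, toeplitz Y (_, _) (b, h) * w (b, h)),
    Fin.sum_univ_succ (n := n) (f := fun b => ∑ h, toeplitz Y (_, _) (b, h) * v (b, h)),
    hv, hw, hs, hT, zero_mul, mul_zero, Finset.sum_const_zero, add_zero, zero_add]

/-- Since `T(Y)` dominates `embed00 n W`, an isotropic vector has zero first block. Its shift is
again isotropic, so the next block vanishes, and so on through all blocks. -/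
theorem toeplitz_posDef {Y : BlockRow m n} {W : Matrix (Fin m) (Fin m) ℝ} (hW : W.PosDef)
    (h : (toeplitz Y - embed00 n W).PosSemidef) : (toeplitz Y).PosDef := by
  have hT : (toeplitz Y).PosSemidef := by
    simpa using h.add (embed00_posSemidef hW.posSemidef)
  have hzero : ∀ v, v ⬝ᵥ (toeplitz Y *ᵥ v) = 0 → ∀ k, v (0, k) = 0 := by
    intro v hv
    have h1 : 0 ≤ v ⬝ᵥ ((toeplitz Y - embed00 n W) *ᵥ v) := by
      simpa using h.dotProduct_mulVec_nonneg v
    have h2 : v ⬝ᵥ (embed00 n W *ᵥ v) = (fun k => v (0, k)) ⬝ᵥ (W *ᵥ fun k => v (0, k)) := by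
      simp only [dotProduct, mulVec, Fintype.sum_prod_type]
      rw [Finset.sum_eq_single 0]
      · refine Finset.sum_congr rfl fun k _ => ?_
        rw [Finset.sum_eq_single 0]
        · simp [embed00]
        · intro b _ hb
          simp [embed00, hb]
        · simp
      · intro b _ hb
        simp [embed00, hb]
      · simp
    rw [sub_mulVec, dotProduct_sub, hv, h2] at h1
    have h3 : (fun k => v (0, k)) = 0 := by
      by_contra hne
      have := hW.dotProduct_mulVec_pos hne
      simp only [star_trivial] at this
      linarith
    exact fun k => congrFun h3 k
  have hall : ∀ i : ℕ, ∀ v, v ⬝ᵥ (toeplitz Y *ᵥ v) = 0 →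
      ∀ a : Fin (n + 1), (a : ℕ) ≤ i → ∀ k, v (a, k) = 0 := by
    intro i
    induction i with
    | zero =>
      intro v hv a ha k
      have : a = 0 := by ext; simpa using ha
      subst this
      exact hzero v hv k
    | succ i ih =>
      intro v hv a ha k
      have h0 := hzero v hv
      induction a using Fin.cases with
      | zero => exact h0 k
      | succ a =>
        let w : Fin (n + 1) × Fin m → ℝ := fun p =>
          Fin.lastCases (motive := fun _ => ℝ) 0 (fun a : Fin n => v (a.succ, p.2)) p.1
        have hs : ∀ (a : Fin n) k, w (a.castSucc, k) = v (a.succ, k) := by simp [w]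
        have hw : w ⬝ᵥ (toeplitz Y *ᵥ w) = 0 := by
          rw [dotProduct_toeplitz_mulVec Y v w h0 hs (by simp [w]), hv]
        rw [← hs]
        refine ih w hw a.castSucc ?_ k
        simp only [Fin.val_succ] at ha
        simp only [Fin.val_castSucc]
        omega
  refine PosDef.of_dotProduct_mulVec_pos hT.1 fun x hx => ?_
  refine lt_of_le_of_ne (hT.dotProduct_mulVec_nonneg x) fun h0 => hx ?_
  ext ⟨a, k⟩
  exact hall n x (by simpa using h0.symm) a (Nat.lt_succ_iff.mp a.isLt) k

/-! ### The symbol on the circle versus the coefficients `D_j`. -/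

theorem symbol_apply (X : BlockMat m n) (z : Circle) (k h : Fin m) :
    symbol X z k h = ∑ a : Fin (n + 1), ∑ b : Fin (n + 1),
      (z : ℂ) ^ (a : ℕ) * X (a, k) (b, h) * star (z : ℂ) ^ (b : ℕ) := by
  have h1 : ∀ q, (shiftOp m n z * X.map (algebraMap ℝ ℂ)) k q =
      ∑ a : Fin (n + 1), (z : ℂ) ^ (a : ℕ) * X (a, k) q := by
    intro q
    rw [mul_apply, Fintype.sum_prod_type]
    refine Finset.sum_congr rfl fun a _ => ?_
    simp [shiftOp]
  rw [symbol, mul_apply, Fintype.sum_prod_type, Finset.sum_comm' (t' := Finset.univ)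
    (s' := fun _ => Finset.univ) (by simp)]
  rw [Finset.sum_eq_single h]
  · rw [Finset.sum_comm]
    refine Finset.sum_congr rfl fun b _ => ?_
    rw [h1, Finset.sum_mul]
    refine Finset.sum_congr rfl fun a _ => ?_
    simp [shiftOp]
  · intro q _ hq
    refine Finset.sum_eq_zero fun b _ => ?_
    simp [shiftOp, hq.symm]
  · simp

/-- Multiplying by `z ^ n` turns the Laurent polynomial into a polynomial; since `b ≤ n`, the
natural subtraction does not truncate. -/
theorem pow_mul_symbol_apply (X : BlockMat m n) (z : Circle) (k h : Fin m) :
    (z : ℂ) ^ n * symbol X z k h = ∑ a : Fin (n + 1), ∑ b : Fin (n + 1),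
      (X (a, k) (b, h) : ℂ) * (z : ℂ) ^ (n + a - b : ℕ) := by
  rw [symbol_apply]
  simp only [Finset.mul_sum]
  refine Finset.sum_congr rfl fun a _ => Finset.sum_congr rfl fun b _ => ?_
  have hz : (z : ℂ) * star (z : ℂ) = 1 := by
    have := Circle.normSq_coe z
    simp [Complex.mul_conj, this]
  have hb : (b : ℕ) ≤ n := Nat.lt_succ_iff.mp b.isLt
  have h1 : (z : ℂ) ^ (n + a : ℕ) = (z : ℂ) ^ (n + a - b : ℕ) * (z : ℂ) ^ (b : ℕ) := by
    rw [← pow_add]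
    congr 1
    omega
  have h2 : (z : ℂ) ^ (b : ℕ) * star (z : ℂ) ^ (b : ℕ) = 1 := by
    rw [← mul_pow, hz, one_pow]
  rw [pow_add] at h1
  linear_combination (X (a, k) (b, h) : ℂ) * star (z : ℂ) ^ (b : ℕ) * h1 +
    (X (a, k) (b, h) : ℂ) * (z : ℂ) ^ (n + a - b : ℕ) * h2

theorem blockDiagSum_eq_zero_of_symbol_eq_zero {X : BlockMat m n} {k h : Fin m}
    (hX : ∀ z, symbol X z k h = 0) (j : Fin (n + 1)) : blockDiagSum X j k h = 0 := by
  open Polynomial in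
  let P : ℂ[X] := ∑ a : Fin (n + 1), ∑ b : Fin (n + 1),
    C (X (a, k) (b, h) : ℂ) * Polynomial.X ^ (n + a - b : ℕ)
  have hP : P = 0 := by
    refine Polynomial.eq_zero_of_infinite_isRoot P ?_
    have : Infinite Circle := Circle.argEquiv.infinite_iff.mpr
      (Set.Ioc.infinite (neg_lt_self Real.pi_pos))
    have hinf : (Set.range (fun z : Circle => (z : ℂ))).Infinite :=
      Set.infinite_range_of_injective Circle.coe_injective
    refine hinf.mono ?_
    rintro _ ⟨z, rfl⟩
    simp only [Set.mem_ofPred_eq, Polynomial.IsRoot.def, P, Polynomial.eval_finsetSum,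
      Polynomial.eval_mul, Polynomial.eval_C, Polynomial.eval_pow, Polynomial.eval_X]
    rw [← pow_mul_symbol_apply, hX, mul_zero]
  -- The coefficient of degree `n - j` collects exactly the blocks with `b - a = j`.
  have hc : P.coeff (n - j) = 0 := by rw [hP, Polynomial.coeff_zero]
  simp only [P, Polynomial.finsetSum_coeff, Polynomial.coeff_C_mul, Polynomial.coeff_X_pow,
    mul_ite, mul_one, mul_zero] at hc
  rw [blockDiagSum_apply]
  refine mul_eq_zero_of_right _ ?_
  rw [← Complex.ofReal_eq_zero, ← hc]
  push_cast
  refine Finset.sum_congr rfl fun a _ => Finset.sum_congr rfl fun b _ => ?_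
  have : ((a : ℕ) + j = b) ↔ (n - j : ℕ) = n + a - b := by
    have := a.isLt
    have := b.isLt
    have := j.isLt
    omega
  simp only [this]
  split_ifs <;> simp

/-- Both orders of the pair are needed: `D` only reads blocks on or above the diagonal, and symmetry
of `X` turns entry `(k, h)` of a lower block into entry `(h, k)` of an upper one. -/
theorem symbol_eq_zero_of_blockDiagSum_eq_zero {X : BlockMat m n} (hX : X.IsSymm) {k h : Fin m}
    (h1 : ∀ j, blockDiagSum X j k h = 0) (h2 : ∀ j, blockDiagSum X j h k = 0) (z : Circle) :
    symbol X z k h = 0 := by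
  have hS : ∀ {k h}, (∀ j, blockDiagSum X j k h = 0) → ∀ j : Fin (n + 1),
      ∑ a : Fin (n + 1), ∑ b : Fin (n + 1),
        (if (a : ℕ) + j = b then (X (a, k) (b, h) : ℂ) else 0) = 0 := by
    intro k h hD j
    have := hD j
    rw [blockDiagSum_apply, mul_eq_zero, or_iff_right (by split_ifs <;> norm_num)] at this
    rw [← Complex.ofReal_eq_zero] at this
    refine Eq.trans ?_ this
    push_cast
    refine Finset.sum_congr rfl fun a _ => Finset.sum_congr rfl fun b _ => ?_
    split_ifs <;> simp
  have hsum : ∀ {k h}, (∀ j, blockDiagSum X j k h = 0) → ∀ f : ℕ → ℂ,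
      ∑ a : Fin (n + 1), ∑ b : Fin (n + 1),
        (if a ≤ b then (X (a, k) (b, h) : ℂ) * f (b - a) else 0) = 0 := by
    intro k h hD f
    rw [← sum_shift (fun j a b => (X (a, k) (b, h) : ℂ) * f j)]
    refine Finset.sum_eq_zero fun j _ => ?_
    refine Eq.trans ?_ (congrArg (· * f j) (hS hD j) |>.trans (zero_mul _))
    simp only [Finset.sum_mul, ite_mul, zero_mul]
  have hz : (z : ℂ) ^ n ≠ 0 := pow_ne_zero _ (Circle.coe_ne_zero z)
  refine (mul_eq_zero.mp ?_).resolve_left hz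
  rw [pow_mul_symbol_apply]
  have e1 := hsum h1 (fun j => (z : ℂ) ^ (n - j))
  -- The value `0` at `j = 0` keeps the diagonal blocks from being counted twice.
  have e2 := hsum h2 (fun j => if j = 0 then 0 else (z : ℂ) ^ (n + j))
  rw [Finset.sum_comm] at e2
  refine Eq.trans ?_ ((congrArg₂ (· + ·) e1 e2).trans (add_zero 0))
  simp only [← Finset.sum_add_distrib]
  refine Finset.sum_congr rfl fun a _ => Finset.sum_congr rfl fun b _ => ?_
  have hsym : X (b, h) (a, k) = X (a, k) (b, h) := hX.apply _ _
  have ha := a.isLt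
  have hb := b.isLt
  simp only [Fin.le_def, hsym]
  rcases lt_trichotomy (a : ℕ) b with hab | hab | hab
  · rw [if_pos hab.le, if_neg hab.not_ge, add_zero]
    congr 2
    omega
  · simp [hab]
  · rw [if_neg hab.not_ge, if_pos hab.le, if_neg (by omega), zero_add]
    congr 2
    omega

/-! ### The regularizer `h_∞` and its dual constraints. -/

/-- The sup norm of the vector of the entries `(k,h)` and `(h,k)` of `Y_0, …, Y_n`. -/
def pairMax (Y : BlockRow m n) (k h : Fin m) : ℝ :=
  Finset.univ.sup' Finset.univ_nonempty (fun j : Fin (n + 1) => max |Y j k h| |Y j h k|)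

theorem hInf_eq (Y : BlockRow m n) :
    hInf Y = ∑ k : Fin m, ∑ h ∈ Finset.univ.filter (fun h : Fin m => h < k), pairMax Y k h := rfl

theorem abs_le_pairMax (Y : BlockRow m n) (j : Fin (n + 1)) (k h : Fin m) :
    |Y j k h| ≤ pairMax Y k h ∧ |Y j h k| ≤ pairMax Y k h := by
  have := Finset.le_sup' (fun j : Fin (n + 1) => max |Y j k h| |Y j h k|) (Finset.mem_univ j)
  exact max_le_iff.mp this

theorem pairMax_le_iff {Y : BlockRow m n} {k h : Fin m} {c : ℝ} :
    pairMax Y k h ≤ c ↔ ∀ j, |Y j k h| ≤ c ∧ |Y j h k| ≤ c := by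
  simp [pairMax, Finset.sup'_le_iff]

theorem pairMax_nonneg (Y : BlockRow m n) (k h : Fin m) : 0 ≤ pairMax Y k h :=
  (abs_nonneg _).trans (abs_le_pairMax Y 0 k h).1

theorem hInf_add_smul_le {a b : ℝ} (ha : 0 ≤ a) (hb : 0 ≤ b) (Y Y' : BlockRow m n) :
    hInf (a • Y + b • Y') ≤ a * hInf Y + b * hInf Y' := by
  simp only [hInf_eq, Finset.mul_sum, ← Finset.sum_add_distrib]
  refine Finset.sum_le_sum fun k _ => Finset.sum_le_sum fun h _ => ?_
  have key : ∀ x y p q : ℝ, |x| ≤ p → |y| ≤ q → |a * x + b * y| ≤ a * p + b * q := by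
    intro x y p q hx hy
    refine (abs_add_le _ _).trans ?_
    rw [abs_mul, abs_mul, abs_of_nonneg ha, abs_of_nonneg hb]
    gcongr
  rw [pairMax_le_iff]
  intro j
  exact ⟨key _ _ _ _ (abs_le_pairMax Y j k h).1 (abs_le_pairMax Y' j k h).1,
    key _ _ _ _ (abs_le_pairMax Y j k h).2 (abs_le_pairMax Y' j k h).2⟩

theorem hInf_smul_le {a : ℝ} (ha : 0 ≤ a) (Y : BlockRow m n) : hInf (a • Y) ≤ a * hInf Y := by
  simpa using hInf_add_smul_le ha le_rfl Y 0

theorem continuous_hInf : Continuous (hInf : BlockRow m n → ℝ) := by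
  refine continuous_finsetSum _ fun k _ => continuous_finsetSum _ fun h _ => ?_
  refine Continuous.finset_sup'_apply _ fun j _ => ?_
  have hc : ∀ k h, Continuous fun Y : BlockRow m n => |Y j k h| := fun k h =>
    ((continuous_apply j).matrix_elem k h).abs
  exact (hc k h).max (hc h k)

theorem pairing_add_right (Z Y Y' : BlockRow m n) :
    pairing Z (Y + Y') = pairing Z Y + pairing Z Y' := by
  simp [pairing, mul_add, Finset.sum_add_distrib]

theorem pairing_smul_right (c : ℝ) (Z Y : BlockRow m n) :
    pairing Z (c • Y) = c * pairing Z Y := by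
  simp [pairing, Finset.mul_sum, mul_left_comm]

theorem pairing_smul_left (c : ℝ) (Z Y : BlockRow m n) :
    pairing (c • Z) Y = c * pairing Z Y := by
  simp [pairing, Finset.mul_sum, mul_assoc]

theorem pairing_eq_sum_lt {Z Y : BlockRow m n} (h0 : ∀ j k, Z j k k * Y j k k = 0) :
    pairing Z Y = ∑ k : Fin m, ∑ h ∈ Finset.univ.filter (fun h : Fin m => h < k),
      ∑ j, (Z j k h * Y j k h + Z j h k * Y j h k) := by
  have h1 : pairing Z Y = ∑ k, ∑ h, ∑ j, Z j k h * Y j k h := by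
    rw [pairing, Finset.sum_comm]
    exact Finset.sum_congr rfl fun k _ => Finset.sum_comm
  rw [h1, sum_sum_eq_sum_sum_lt]
  · simp only [Finset.sum_add_distrib]
  · exact fun k => Finset.sum_eq_zero fun j _ => h0 j k

/-- Hölder's inequality between `ℓ¹` and `ℓ^∞` for one pair. -/
theorem pair_sum_le (Z Y : BlockRow m n) (k h : Fin m) :
    ∑ j, (Z j k h * Y j k h + Z j h k * Y j h k) ≤
      (∑ j, (|Z j k h| + |Z j h k|)) * pairMax Y k h := by
  rw [Finset.sum_mul]
  refine Finset.sum_le_sum fun j _ => ?_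
  rw [add_mul]
  obtain ⟨h1, h2⟩ := abs_le_pairMax Y j k h
  have key : ∀ x y p : ℝ, |y| ≤ p → x * y ≤ |x| * p := fun x y p hy =>
    (le_abs_self _).trans (by rw [abs_mul]; gcongr)
  exact add_le_add (key _ _ _ h1) (key _ _ _ h2)

/-- Weak duality for the sparsity regularizer, with its equality case. -/
theorem pairing_le_hInf {Z : BlockRow m n} {c : ℝ} (h0 : ∀ j k, Z j k k = 0)
    (hc : ∀ k h, k ≠ h → ∑ j, (|Z j k h| + |Z j h k|) ≤ c) (Y : BlockRow m n) :
    pairing Z Y ≤ c * hInf Y ∧ (c * hInf Y ≤ pairing Z Y →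
      ∀ k h, k ≠ h → ∑ j, (|Z j k h| + |Z j h k|) < c → ∀ j, Y j k h = 0) := by
  rw [pairing_eq_sum_lt (fun j k => by simp [h0]), hInf_eq]
  simp only [Finset.mul_sum]
  have hle : ∀ k, ∀ h ∈ Finset.univ.filter (fun h : Fin m => h < k),
      ∑ j, (Z j k h * Y j k h + Z j h k * Y j h k) ≤ c * pairMax Y k h := fun k h hk =>
    (pair_sum_le Z Y k h).trans (mul_le_mul_of_nonneg_right
      (hc k h (Finset.mem_filter.mp hk).2.ne') (pairMax_nonneg Y k h))
  have hle' := fun k (_ : k ∈ Finset.univ) => Finset.sum_le_sum (hle k)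
  refine ⟨Finset.sum_le_sum hle', fun hge => ?_⟩
  have heq := (Finset.sum_eq_sum_iff_of_le hle').mp (le_antisymm (Finset.sum_le_sum hle') hge)
  -- Equality bounds `c M` by `s M`, where `M ≥ 0` is the pair norm and `s < c` the `ℓ¹` sum, so `M
  -- = 0`.
  have hzero : ∀ k h, h < k → ∑ j, (|Z j k h| + |Z j h k|) < c → pairMax Y k h = 0 := by
    intro k h hk hlt
    have h1 := (Finset.sum_eq_sum_iff_of_le (hle k)).mp (heq k (Finset.mem_univ k)) h
      (by simpa using hk)
    have h2 := pair_sum_le Z Y k h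
    have h3 := pairMax_nonneg Y k h
    nlinarith
  intro k h hkh hlt j
  rcases lt_or_gt_of_ne hkh with hk | hk
  · have h1 := hzero h k hk (by simpa only [add_comm] using hlt)
    have h2 := (abs_le_pairMax Y j h k).2
    rw [h1] at h2
    exact abs_nonpos_iff.mp h2
  · have h1 := hzero k h hk hlt
    have h2 := (abs_le_pairMax Y j k h).1
    rw [h1] at h2
    exact abs_nonpos_iff.mp h2

theorem abs_sign_le_one (x : ℝ) : |(SignType.sign x : ℝ)| ≤ 1 := by
  rcases lt_trichotomy x 0 with h | h | h <;> simp [h]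

/-- A block row whose pairing is dominated by `c h_∞` satisfies the dual constraints. -/
theorem dual_constraints_of_pairing_le {Z : BlockRow m n} {c : ℝ} (hc : 0 ≤ c)
    (hZ : ∀ Y, pairing Z Y ≤ c * hInf Y) :
    (∀ j k, Z j k k = 0) ∧ ∀ k h, k ≠ h → ∑ j, (|Z j k h| + |Z j h k|) ≤ c := by
  have hdiag : ∀ j k, Z j k k = 0 := by
    intro j k
    -- `h_∞` ignores diagonal entries, so testing against the entry itself bounds its square by `0`.
    let Y : BlockRow m n := fun j' => Matrix.of fun k' h' =>
      if j' = j ∧ k' = k ∧ h' = k then Z j k k else 0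
    have h1 : pairing Z Y = Z j k k * Z j k k := by
      rw [pairing, Finset.sum_eq_single j, Finset.sum_eq_single k, Finset.sum_eq_single k]
      · simp [Y]
      all_goals simp +contextual [Y]
    have h2 : hInf Y ≤ 0 := by
      rw [hInf_eq]
      refine Finset.sum_nonpos fun k' _ => Finset.sum_nonpos fun h' hh => ?_
      rw [pairMax_le_iff]
      have hne := (Finset.mem_filter.mp hh).2.ne
      intro j'
      have e1 : Y j' k' h' = 0 := if_neg fun ⟨_, e1, e2⟩ => hne (e2.trans e1.symm)
      have e2 : Y j' h' k' = 0 := if_neg fun ⟨_, e1, e2⟩ => hne (e1.trans e2.symm)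
      simp [e1, e2]
    have := hZ Y
    rw [h1] at this
    exact mul_self_eq_zero.mp (le_antisymm (this.trans (mul_nonpos_of_nonneg_of_nonpos hc h2))
      (mul_self_nonneg _))
  have hlt : ∀ k h, h < k → ∑ j, (|Z j k h| + |Z j h k|) ≤ c := by
    intro k h hk
    -- The sign pattern is extremal in Hölder's inequality: its pairing is the `ℓ¹` sum while `h_∞ ≤
    -- 1`.
    let Y : BlockRow m n := fun j => Matrix.of fun k' h' =>
      if (k' = k ∧ h' = h) ∨ (k' = h ∧ h' = k) then (SignType.sign (Z j k' h') : ℝ) else 0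
    have hY : ∀ k' h' : Fin m, h' < k' → ¬ (k' = k ∧ h' = h) →
        ∀ j, Y j k' h' = 0 ∧ Y j h' k' = 0 := by
      intro k' h' hk' hne j
      constructor
      · refine if_neg ?_
        rintro (h1 | ⟨rfl, rfl⟩)
        exacts [hne h1, hk'.not_gt hk]
      · refine if_neg ?_
        rintro (⟨rfl, rfl⟩ | ⟨h1, h2⟩)
        exacts [hk'.not_gt hk, hne ⟨h2, h1⟩]
    have e1 : ∀ j, Y j k h = SignType.sign (Z j k h) := fun j => by simp [Y]
    have e2 : ∀ j, Y j h k = SignType.sign (Z j h k) := fun j => by simp [Y]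
    have h1 : pairing Z Y = ∑ j, (|Z j k h| + |Z j h k|) := by
      rw [pairing_eq_sum_lt (fun j k => by simp [hdiag]), Finset.sum_eq_single k,
        Finset.sum_eq_single h]
      · simp only [e1, e2, self_mul_sign]
      · intro h' hh' hne
        refine Finset.sum_eq_zero fun j _ => ?_
        obtain ⟨e1, e2⟩ := hY k h' (Finset.mem_filter.mp hh').2 (fun e => hne e.2) j
        simp [e1, e2]
      · simp [hk]
      · intro k' _ hne
        refine Finset.sum_eq_zero fun h' hh' => Finset.sum_eq_zero fun j _ => ?_
        obtain ⟨e1, e2⟩ := hY k' h' (Finset.mem_filter.mp hh').2 (fun e => hne e.1) j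
        simp [e1, e2]
      · simp
    have h2 : hInf Y ≤ 1 := by
      rw [hInf_eq, Finset.sum_eq_single k, Finset.sum_eq_single h]
      · rw [pairMax_le_iff]
        exact fun j => by rw [e1, e2]; exact ⟨abs_sign_le_one _, abs_sign_le_one _⟩
      · intro h' hh' hne
        refine le_antisymm (pairMax_le_iff.mpr fun j => ?_) (pairMax_nonneg _ _ _)
        obtain ⟨e1, e2⟩ := hY k h' (Finset.mem_filter.mp hh').2 (fun e => hne e.2) j
        simp [e1, e2]
      · simp [hk]
      · intro k' _ hne
        refine Finset.sum_eq_zero fun h' hh' => ?_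
        refine le_antisymm (pairMax_le_iff.mpr fun j => ?_) (pairMax_nonneg _ _ _)
        obtain ⟨e1, e2⟩ := hY k' h' (Finset.mem_filter.mp hh').2 (fun e => hne e.1) j
        simp [e1, e2]
      · simp
    rw [← h1]
    exact (hZ Y).trans (mul_le_of_le_one_right hc h2)
  refine ⟨hdiag, fun k h hkh => ?_⟩
  rcases lt_or_gt_of_ne hkh with hk | hk
  · simpa only [add_comm] using hlt h k hk
  · exact hlt k h hk

theorem exists_pairing_eq (f : BlockRow m n →ₗ[ℝ] ℝ) : ∃ Z, ∀ Y, f Y = pairing Z Y := by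
  refine ⟨fun j => Matrix.of fun k h => f (Pi.single j (Matrix.single k h 1)), fun Y => ?_⟩
  have hY : Y = ∑ j, ∑ k, ∑ h, Y j k h • Pi.single j (Matrix.single k h (1 : ℝ)) := by
    funext j'
    simp only [Finset.sum_apply, Pi.smul_apply]
    rw [Finset.sum_eq_single j']
    · conv_lhs => rw [matrix_eq_sum_single (Y j')]
      simp
    · intro j _ hj
      simp [Pi.single_eq_of_ne hj.symm]
    · simp
  conv_lhs => rw [hY]
  simp [pairing, mul_comm]

/-- The block row with `Z_0` replaced by its symmetric part. -/
noncomputable def symmetrize (Z : BlockRow m n) : BlockRow m n := fun j =>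
  if j = 0 then (2⁻¹ : ℝ) • (Z 0 + (Z 0)ᵀ) else Z j

theorem symmetrize_zero_isSymm (Z : BlockRow m n) : (symmetrize Z 0).IsSymm := by
  simp [symmetrize, IsSymm, add_comm]

/-- `D_0(X)` is symmetric, so only the symmetric part of `Z_0` is seen. This makes an arbitrary
multiplier satisfy the symmetry required in the dual. -/
theorem pairing_symmetrize (Z : BlockRow m n) {X : BlockMat m n} (hX : X.IsSymm) :
    pairing (symmetrize Z) (blockDiagSum X) = pairing Z (blockDiagSum X) := by
  refine Finset.sum_congr rfl fun j _ => ?_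
  by_cases hj : j = 0
  · subst hj
    have h1 : ∑ k, ∑ h, Z 0 h k * blockDiagSum X 0 k h =
        ∑ k, ∑ h, Z 0 k h * blockDiagSum X 0 k h := by
      rw [Finset.sum_comm]
      refine Finset.sum_congr rfl fun k _ => Finset.sum_congr rfl fun h _ => ?_
      rw [blockDiagSum_zero_symm hX]
    have h2 : ∀ k h, symmetrize Z 0 k h * blockDiagSum X 0 k h =
        2⁻¹ * (Z 0 k h * blockDiagSum X 0 k h) + 2⁻¹ * (Z 0 h k * blockDiagSum X 0 k h) := by
      intro k h
      simp [symmetrize]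
      ring
    simp only [h2, Finset.sum_add_distrib, ← Finset.mul_sum, h1]
    ring
  · simp [symmetrize, hj]

theorem symmetrize_constraints {Z : BlockRow m n} {c : ℝ} (h0 : ∀ j k, Z j k k = 0)
    (hc : ∀ k h, k ≠ h → ∑ j, (|Z j k h| + |Z j h k|) ≤ c) :
    (∀ j k, symmetrize Z j k k = 0) ∧
      ∀ k h, k ≠ h → ∑ j, (|symmetrize Z j k h| + |symmetrize Z j h k|) ≤ c := by
  refine ⟨fun j k => ?_, fun k h hkh => (Finset.sum_le_sum fun j _ => ?_).trans (hc k h hkh)⟩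
  · by_cases hj : j = 0 <;> simp [symmetrize, hj, h0]
  · by_cases hj : j = 0
    · subst hj
      simp only [symmetrize, if_true, Matrix.smul_apply, Matrix.add_apply, transpose_apply,
        smul_eq_mul, abs_mul]
      have h1 := abs_add_le (Z 0 k h) (Z 0 h k)
      have h2 := abs_add_le (Z 0 h k) (Z 0 k h)
      rw [abs_of_pos (by norm_num : (0 : ℝ) < 2⁻¹)]
      linarith
    · simp [symmetrize, hj]

/-! ### The semidefinite cone and the Frobenius pairing. -/

theorem toeplitz_smul (c : ℝ) (Y : BlockRow m n) : toeplitz (c • Y) = c • toeplitz Y := by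
  ext p q
  simp only [toeplitz, of_apply, Matrix.smul_apply, Pi.smul_apply]
  split_ifs <;> rfl

theorem _root_.Matrix.PosSemidef.isSymm_real {ι : Type*} {A : Matrix ι ι ℝ}
    (hA : A.PosSemidef) : A.IsSymm := by
  simpa [IsSymm, IsHermitian] using hA.1

theorem frob_nonneg {A B : BlockMat m n} (hA : A.PosSemidef) (hB : B.PosSemidef) :
    0 ≤ frob A B := by
  rw [frob, hB.isSymm_real.eq]
  exact (mul_eq_zero_of_trace_mul_eq_zero hA hB).1

theorem mul_eq_zero_of_frob_nonpos {A B : BlockMat m n} (hA : A.PosSemidef) (hB : B.PosSemidef)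
    (h : frob A B ≤ 0) : A * B = 0 := by
  have h0 := le_antisymm h (frob_nonneg hA hB)
  rw [frob, hB.isSymm_real.eq] at h0
  exact (mul_eq_zero_of_trace_mul_eq_zero hA hB).2 h0

theorem frob_one_left (X : BlockMat m n) : frob 1 X = X.trace := by simp [frob]

theorem frob_slackV (lam : ℝ) (Z : BlockRow m n) {X : BlockMat m n} (hX : X.IsSymm) :
    frob (slackV lam Z) X = lam * X.trace + pairing Z (blockDiagSum X) := by
  rw [slackV, frob_add_left, frob_smul_left, frob_one_left, frob_toeplitz Z hX]

theorem frob_vecMulVec (A : BlockMat m n) (v : Fin (n + 1) × Fin m → ℝ) :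
    frob A (vecMulVec v v) = v ⬝ᵥ (A *ᵥ v) := by
  rw [frob_eq_sum]
  simp only [dotProduct, mulVec, Finset.mul_sum, vecMulVec_apply]
  refine Finset.sum_congr rfl fun p _ => Finset.sum_congr rfl fun q _ => ?_
  ring

theorem vecMulVec_posSemidef (v : Fin (n + 1) × Fin m → ℝ) :
    (vecMulVec v v : BlockMat m n).PosSemidef := by
  simpa using posSemidef_vecMulVec_self_star v

theorem posSemidef_of_frob_nonneg {A : BlockMat m n} (hA : A.IsSymm)
    (h : ∀ B : BlockMat m n, B.PosDef → 0 ≤ frob A B) : A.PosSemidef := by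
  refine PosSemidef.of_dotProduct_mulVec_nonneg (by
    rw [IsHermitian, conjTranspose_eq_transpose_of_trivial]; exact hA) fun v => ?_
  rw [star_trivial]
  by_contra hneg
  push Not at hneg
  have key : ∀ ε : ℝ, 0 < ε → 0 ≤ ε * A.trace + v ⬝ᵥ (A *ᵥ v) := by
    intro ε hε
    have hpd : (ε • (1 : BlockMat m n) + vecMulVec v v).PosDef :=
      (PosDef.one.smul hε).add_posSemidef (vecMulVec_posSemidef v)
    have := h _ hpd
    rw [frob_add_right, frob_smul_right, frob_vecMulVec] at this
    simpa [frob] using this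
  set q := v ⬝ᵥ (A *ᵥ v)
  -- With this size the `ε`-term is at most `-q / 2`, so the total is at most `q / 2 < 0`.
  set ε := -q / (2 * (|A.trace| + 1)) with hε
  have hε0 : 0 < ε := div_pos (by linarith) (by positivity)
  have h1 := key ε hε0
  have h2 : ε * (|A.trace| + 1) = -q / 2 := by
    rw [hε]
    field_simp
  have h3 := mul_le_mul_of_nonneg_left (le_abs_self A.trace) hε0.le
  linarith

/-! ### The log-determinant term: lower bound, attainment, convexity. -/

/-- The part of the primal objective that depends on `X` only. -/
noncomputable def logDetObj (A X : BlockMat m n) : ℝ := -Real.log (block X 0 0).det + frob A X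

/-- `⟨A, X⟩` splits into `⟨A - embed00 n W, X⟩ ≥ 0` and `tr(W X_{00})`; the Fenchel inequality
handles the latter. -/
theorem add_le_logDetObj {A X : BlockMat m n} {W : Matrix (Fin m) (Fin m) ℝ} (hW : W.PosDef)
    (hA : (A - embed00 n W).PosSemidef) (hX : X.PosSemidef) (hX0 : (block X 0 0).PosDef) :
    Real.log W.det + m + frob (A - embed00 n W) X ≤ logDetObj A X ∧
      (logDetObj A X ≤ Real.log W.det + m → block X 0 0 = W⁻¹ ∧ (A - embed00 n W) * X = 0) := by
  have h1 : frob A X = frob (A - embed00 n W) X + (W * block X 0 0).trace := by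
    rw [← frob_embed00 W hX.isSymm_real, ← frob_add_left, sub_add_cancel]
  obtain ⟨h2, h3⟩ := log_det_add_log_det_add_card_le hW hX0
  rw [Fintype.card_fin] at h2 h3
  have h4 := frob_nonneg hA hX
  rw [logDetObj, h1]
  exact ⟨by linarith, fun h => ⟨h3 (by linarith), mul_eq_zero_of_frob_nonpos hA hX (by linarith)⟩⟩

/-- For `A ≻ 0` the inner minimization over `X` is attained, with dual certificate
`W = ((A⁻¹)_{00})⁻¹`. -/
theorem exists_logDetObj_eq {A : BlockMat m n} (hA : A.PosDef) :
    ∃ (W : Matrix (Fin m) (Fin m) ℝ) (X : BlockMat m n), W.PosDef ∧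
      (A - embed00 n W).PosSemidef ∧ X.PosSemidef ∧ (block X 0 0).PosDef ∧
      logDetObj A X = Real.log W.det + m := by
  set E := firstBlock m n with hE
  have hB : (block A⁻¹ 0 0).PosDef := hA.inv.submatrix (e := fun k => (0, k)) fun k h hkh => by
    simpa using hkh
  set W := (block A⁻¹ 0 0)⁻¹ with hWdef
  have hW : W.PosDef := hB.inv
  have hAis : A⁻¹ᵀ = A⁻¹ := hA.inv.posSemidef.isSymm_real.eq
  have hBW : Eᵀ * A⁻¹ * E * W = 1 := by
    rw [← block_zero_zero, hWdef]
    exact mul_nonsing_inv _ hB.det_pos.ne'.isUnit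
  have hAA : A * A⁻¹ = 1 := mul_nonsing_inv _ hA.det_pos.ne'.isUnit
  have hAA' : A⁻¹ * A = 1 := nonsing_inv_mul _ hA.det_pos.ne'.isUnit
  have hWB : W * (Eᵀ * A⁻¹ * E) = 1 := mul_eq_one_comm.mp hBW
  -- The solution of the slackness equations `(A - E W Eᵀ) X = 0`, `X_{00} = W⁻¹`.
  let X : BlockMat m n := A⁻¹ * E * W * (A⁻¹ * E)ᵀ
  have hX : X.PosSemidef := by
    have := hW.posSemidef.mul_mul_conjTranspose_same (A⁻¹ * E)
    rwa [conjTranspose_eq_transpose_of_trivial] at this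
  have hX0 : block X 0 0 = block A⁻¹ 0 0 := by
    rw [block_zero_zero, block_zero_zero]
    have : Eᵀ * X * E = (Eᵀ * A⁻¹ * E * W) * (Eᵀ * A⁻¹ * E) := by
      simp only [X, transpose_mul, hAis, Matrix.mul_assoc]
    rw [this, hBW, Matrix.one_mul]
  refine ⟨W, X, hW, ?_, hX, hX0 ▸ hB, ?_⟩
  · have h1 : A - embed00 n W =
        (1 - embed00 n W * A⁻¹) * A * (1 - embed00 n W * A⁻¹)ᴴ := by
      have h2 : embed00 n W * A⁻¹ * embed00 n W = embed00 n W := by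
        rw [embed00_eq, ← hE]
        have : E * W * Eᵀ * A⁻¹ * (E * W * Eᵀ) = E * W * (Eᵀ * A⁻¹ * E * W) * Eᵀ := by
          simp only [Matrix.mul_assoc]
        rw [this, hBW, Matrix.mul_one]
      have h3 : (embed00 n W)ᵀ = embed00 n W := (embed00_posSemidef hW.posSemidef).isSymm_real.eq
      rw [conjTranspose_eq_transpose_of_trivial, transpose_sub, transpose_mul, h3, hAis,
        transpose_one, sub_mul, one_mul, mul_sub, mul_one, Matrix.mul_assoc _ A⁻¹ A, hAA', mul_one,
        sub_mul, ← Matrix.mul_assoc A, hAA, one_mul, ← Matrix.mul_assoc, h2]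
      abel
    rw [h1]
    exact hA.posSemidef.mul_mul_conjTranspose_same _
  · have h1 : frob A X = m := by
      rw [frob, hX.isSymm_real.eq]
      have : A * X = E * (W * (Eᵀ * A⁻¹)) := by
        simp only [X, transpose_mul, hAis, ← Matrix.mul_assoc, hAA, Matrix.one_mul]
      rw [this, trace_mul_comm, Matrix.mul_assoc, hWB]
      simp
    rw [logDetObj, h1, hX0, hWdef, det_nonsing_inv, Ring.inverse_eq_inv', Real.log_inv]

/-- Both endpoints lie above the tangent of `-log det` at the combination `S`, and averaging the two
tangent bounds gives the value at `S`. -/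
theorem logDetObj_convex (A : BlockMat m n) {X Y : BlockMat m n} {a b : ℝ} (ha : 0 < a) (hb : 0 < b)
    (hab : a + b = 1) (hX : (block X 0 0).PosDef) (hY : (block Y 0 0).PosDef) :
    (block (a • X + b • Y) 0 0).PosDef ∧
      logDetObj A (a • X + b • Y) ≤ a * logDetObj A X + b * logDetObj A Y := by
  have hblock : block (a • X + b • Y) 0 0 = a • block X 0 0 + b • block Y 0 0 := rfl
  have hS : (a • block X 0 0 + b • block Y 0 0).PosDef := (hX.smul ha).add (hY.smul hb)
  rw [logDetObj, hblock]
  refine ⟨hS, ?_⟩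
  set S := a • block X 0 0 + b • block Y 0 0 with hSdef
  have h1 := (log_det_add_log_det_add_card_le hS.inv hX).1
  have h2 := (log_det_add_log_det_add_card_le hS.inv hY).1
  have h3 : a * (S⁻¹ * block X 0 0).trace + b * (S⁻¹ * block Y 0 0).trace = m := by
    have hT : ∀ T : Matrix (Fin m) (Fin m) ℝ,
        a * (T * block X 0 0).trace + b * (T * block Y 0 0).trace = (T * S).trace := by
      simp [hSdef, mul_add]
    rw [hT, nonsing_inv_mul _ hS.det_pos.ne'.isUnit]
    simp
  rw [det_nonsing_inv, Ring.inverse_eq_inv', Real.log_inv, Fintype.card_fin] at h1 h2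
  rw [frob_add_right, frob_smul_right, frob_smul_right, logDetObj, logDetObj]
  have h4 := mul_le_mul_of_nonneg_left h1 ha.le
  have h5 := mul_le_mul_of_nonneg_left h2 hb.le
  have h6 : b = 1 - a := by linarith
  subst h6
  nlinarith

/-! ### Strong duality and complementary slackness. -/

/-- The primal objective with the argument of `h_∞` perturbed by `U`. -/
noncomputable def perturbedObj (R : BlockRow m n) (lam gam : ℝ) (X L : BlockMat m n)
    (U : BlockRow m n) : ℝ :=
  logDetObj (toeplitz R) X + lam * gam * hInf (blockDiagSum (X + L) + U) + lam * L.trace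

theorem primalObj_eq (R : BlockRow m n) (lam gam : ℝ) (X L : BlockMat m n) :
    primalObj R lam gam X L =
      logDetObj (toeplitz R) X + lam * gam * hInf (blockDiagSum (X + L)) + lam * L.trace := rfl

/-- The strict epigraph of the perturbation function. -/
def strictEpigraph (R : BlockRow m n) (lam gam : ℝ) : Set (BlockRow m n × ℝ) :=
  {p | ∃ X L, PrimalFeasible X L ∧ perturbedObj R lam gam X L p.1 < p.2}

theorem isOpen_strictEpigraph (R : BlockRow m n) (lam gam : ℝ) :
    IsOpen (strictEpigraph R lam gam) := by
  have : strictEpigraph R lam gam = ⋃ X, ⋃ L, ⋃ _ : PrimalFeasible X L,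
      {p : BlockRow m n × ℝ | perturbedObj R lam gam X L p.1 < p.2} := by
    ext p
    simp [strictEpigraph]
  rw [this]
  refine isOpen_iUnion fun X => isOpen_iUnion fun L => isOpen_iUnion fun _ =>
    isOpen_lt ?_ continuous_snd
  have hc : Continuous fun p : BlockRow m n × ℝ => hInf (blockDiagSum (X + L) + p.1) :=
    continuous_hInf.comp (continuous_const.add continuous_fst)
  exact (continuous_const.add (continuous_const.mul hc)).add continuous_const

theorem convex_strictEpigraph (R : BlockRow m n) {lam gam : ℝ} (hlam : 0 < lam) (hgam : 0 < gam) :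
    Convex ℝ (strictEpigraph R lam gam) := by
  rw [convex_iff_forall_pos]
  rintro ⟨U, s⟩ ⟨X, L, ⟨hX0, hX, hL⟩, hlt⟩ ⟨U', s'⟩ ⟨X', L', ⟨hX0', hX', hL'⟩, hlt'⟩ a b ha hb hab
  obtain ⟨hS0, hSle⟩ := logDetObj_convex (toeplitz R) ha hb hab hX0 hX0'
  refine ⟨a • X + b • X', a • L + b • L', ⟨hS0, (hX.smul ha.le).add (hX'.smul hb.le),
    (hL.smul ha.le).add (hL'.smul hb.le)⟩, ?_⟩
  have harg : blockDiagSum (a • X + b • X' + (a • L + b • L')) + (a • U + b • U') =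
      a • (blockDiagSum (X + L) + U) + b • (blockDiagSum (X' + L') + U') := by
    simp only [blockDiagSum_add, blockDiagSum_smul, smul_add]
    abel
  have hh := mul_le_mul_of_nonneg_left (hInf_add_smul_le ha.le hb.le
    (blockDiagSum (X + L) + U) (blockDiagSum (X' + L') + U')) (mul_pos hlam hgam).le
  simp only [perturbedObj] at hlt hlt'
  have h1 := mul_lt_mul_of_pos_left hlt ha
  have h2 := mul_lt_mul_of_pos_left hlt' hb
  simp only [perturbedObj, Prod.fst_add, Prod.snd_add, Prod.smul_fst, Prod.smul_snd, harg,
    trace_add, trace_smul, smul_eq_mul]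
  nlinarith

/-- The perturbation function has a subgradient at `0`. -/
theorem exists_subgradient (R : BlockRow m n) {lam gam : ℝ} (hlam : 0 < lam) (hgam : 0 < gam)
    {X L : BlockMat m n} (hXL : IsPrimalSolution R lam gam X L) :
    ∃ Z : BlockRow m n, ∀ X' L' U, PrimalFeasible X' L' →
      primalObj R lam gam X L + pairing Z U ≤ perturbedObj R lam gam X' L' U := by
  set p := primalObj R lam gam X L with hp
  have h0 : ∀ X' L', perturbedObj R lam gam X' L' 0 = primalObj R lam gam X' L' := fun X' L' => by
    rw [perturbedObj, add_zero, primalObj_eq]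
  have hnot : ((0 : BlockRow m n), p) ∉ strictEpigraph R lam gam := by
    rintro ⟨X', L', hf, hlt⟩
    simp only [h0] at hlt
    exact hlt.not_ge (hXL.2 X' L' hf)
  obtain ⟨f, hf⟩ := geometric_hahn_banach_open_point (convex_strictEpigraph R hlam hgam)
    (isOpen_strictEpigraph R lam gam) hnot
  set s := f (0, 1) with hs
  obtain ⟨Z, hZ⟩ := exists_pairing_eq (f.toLinearMap ∘ₗ LinearMap.inl ℝ (BlockRow m n) ℝ)
  have hfd : ∀ U t, f (U, t) = pairing Z U + t * s := by
    intro U t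
    have : (U, t) = (U, (0 : ℝ)) + t • ((0 : BlockRow m n), (1 : ℝ)) := by simp
    rw [this, map_add, map_smul, ← hZ U]
    simp [hs]
  have hp0 : pairing Z (0 : BlockRow m n) = 0 := by simp [pairing]
  -- The separating hyperplane is not vertical, because a point above `(0, p)` lies in the epigraph.
  have hsneg : s < 0 := by
    have := hf (0, p + 1) ⟨X, L, hXL.1, by simp only [h0]; linarith⟩
    rw [hfd, hfd] at this
    linarith
  refine ⟨(-s)⁻¹ • Z, fun X' L' U hF => ?_⟩
  rw [pairing_smul_left]
  refine le_of_forall_gt_imp_ge_of_dense fun t ht => ?_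
  have := hf (U, t) ⟨X', L', hF, ht⟩
  rw [hfd, hfd, hp0] at this
  have hs' : 0 < -s := by linarith
  have h1 : (-s)⁻¹ * pairing Z U < t - p := by
    rw [inv_mul_lt_iff₀ hs']
    linarith
  linarith

theorem nonpos_of_forall_mul_le {x C : ℝ} (h : ∀ t : ℝ, 1 ≤ t → t * x ≤ C) : x ≤ 0 := by
  by_contra hx
  push Not at hx
  have h1 := h (|C| / x + 1) (by
    have : 0 ≤ |C| / x := by positivity
    linarith)
  have h2 : (|C| / x + 1) * x = |C| + x := by field_simp
  linarith [le_abs_self C]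

theorem block_one_posDef : (block (1 : BlockMat m n) 0 0).PosDef := by
  have : block (1 : BlockMat m n) 0 0 = 1 := by
    ext k h
    simp [block, Matrix.one_apply]
  rw [this]
  exact PosDef.one

theorem block_posDef {X : BlockMat m n} (hX : X.PosDef) : (block X 0 0).PosDef :=
  hX.submatrix (e := fun k => (0, k)) fun k h hkh => by simpa using hkh

/-- Along `X = t B` with `t ≥ 1` the logarithmic term stays bounded above, so `⟨A, B⟩ < 0` would
drive the objective to `-∞`. -/
theorem posSemidef_of_le_logDetObj {A : BlockMat m n} (hA : A.IsSymm) {p : ℝ}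
    (h : ∀ X : BlockMat m n, X.PosSemidef → (block X 0 0).PosDef → p ≤ logDetObj A X) :
    A.PosSemidef := by
  refine posSemidef_of_frob_nonneg hA fun B hB => ?_
  rw [← neg_nonpos]
  refine nonpos_of_forall_mul_le (C := -Real.log (block B 0 0).det - p) fun t ht => ?_
  have ht0 : 0 < t := by linarith
  have h1 := h (t • B) (hB.smul ht0).posSemidef (block_posDef (hB.smul ht0))
  have h2 : block (t • B) 0 0 = t • block B 0 0 := rfl
  rw [logDetObj, h2, det_smul, frob_smul_right,
    Real.log_mul (pow_ne_zero _ ht0.ne') (block_posDef hB).det_pos.ne', Real.log_pow] at h1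
  have h3 : 0 ≤ (Fintype.card (Fin m) : ℝ) * Real.log t :=
    mul_nonneg (Nat.cast_nonneg _) (Real.log_nonneg ht)
  linarith

theorem slackV_isSymm (lam : ℝ) {Z : BlockRow m n} (hZ : (Z 0).IsSymm) :
    (slackV lam Z).IsSymm :=
  (isSymm_one.smul lam).add (toeplitz_isSymm hZ)

/-- A multiplier for the primal problem: a point `Z` satisfying the dual constraints for which the
Lagrangian is bounded below by the primal value. -/
theorem exists_multiplier {R : BlockRow m n} {lam gam : ℝ} (hlam : 0 < lam) (hgam : 0 < gam)
    (hR0 : (R 0).IsSymm) {X L : BlockMat m n} (hXL : IsPrimalSolution R lam gam X L) :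
    ∃ Z : BlockRow m n, (Z 0).IsSymm ∧ (toeplitz R + toeplitz Z).PosSemidef ∧
      (∀ j k, Z j k k = 0) ∧ (∀ k h, k ≠ h → ∑ j, (|Z j k h| + |Z j h k|) ≤ lam * gam) ∧
      (slackV lam Z).PosSemidef ∧
      ∀ X' : BlockMat m n, X'.PosSemidef → (block X' 0 0).PosDef →
        primalObj R lam gam X L ≤ logDetObj (toeplitz R + toeplitz Z) X' := by
  obtain ⟨Y, hY⟩ := exists_subgradient R hlam hgam hXL
  set p := primalObj R lam gam X L with hp
  have hlg := mul_pos hlam hgam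
  have hsub : ∀ (X' L' : BlockMat m n) U, PrimalFeasible X' L' →
      p + pairing Y U - pairing Y (blockDiagSum (X' + L')) ≤
        logDetObj (toeplitz R) X' + lam * gam * hInf U + lam * L'.trace := by
    intro X' L' U hF
    -- This perturbation decouples `h_∞` from `(X', L')`: its argument becomes the free variable
    -- `U`.
    have h1 := hY X' L' (U + (-1 : ℝ) • blockDiagSum (X' + L')) hF
    rw [pairing_add_right, pairing_smul_right, perturbedObj] at h1
    have h2 : blockDiagSum (X' + L') + (U + (-1 : ℝ) • blockDiagSum (X' + L')) = U := by
      rw [neg_one_smul]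
      abel
    rw [h2] at h1
    linarith
  have hone : PrimalFeasible (1 : BlockMat m n) 0 :=
    ⟨block_one_posDef, PosSemidef.one, PosSemidef.zero⟩
  have hpair : ∀ U, pairing Y U ≤ lam * gam * hInf U := by
    intro U
    rw [← sub_nonpos]
    refine nonpos_of_forall_mul_le (C := logDetObj (toeplitz R) 1 + lam * (0 : BlockMat m n).trace
      - p + pairing Y (blockDiagSum (1 + 0 : BlockMat m n))) fun t ht => ?_
    have h1 := hsub 1 0 (t • U) hone
    rw [pairing_smul_right] at h1
    have h2 := mul_le_mul_of_nonneg_left (hInf_smul_le (by linarith : (0 : ℝ) ≤ t) U) hlg.le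
    nlinarith
  obtain ⟨hd, hc⟩ := dual_constraints_of_pairing_le hlg.le hpair
  obtain ⟨hd', hc'⟩ := symmetrize_constraints hd hc
  have hZ0 := symmetrize_zero_isSymm Y
  have hi0 : hInf (0 : BlockRow m n) ≤ 0 := by
    simpa using hInf_smul_le le_rfl (0 : BlockRow m n)
  have hlag : ∀ X' L' : BlockMat m n, PrimalFeasible X' L' →
      p ≤ logDetObj (toeplitz R + toeplitz (symmetrize Y)) X' +
        frob (slackV lam (symmetrize Y)) L' := by
    intro X' L' hF
    have h1 := hsub X' L' 0 hF
    have hX' := hF.2.1.isSymm_real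
    have hL' := hF.2.2.isSymm_real
    have h2 : pairing Y (0 : BlockRow m n) = 0 := by simp [pairing]
    rw [h2, blockDiagSum_add, pairing_add_right, ← pairing_symmetrize Y hX',
      ← pairing_symmetrize Y hL', ← frob_toeplitz _ hX'] at h1
    rw [frob_slackV _ _ hL', logDetObj, frob_add_left]
    rw [logDetObj] at h1
    nlinarith
  have hlagX : ∀ X' : BlockMat m n, X'.PosSemidef → (block X' 0 0).PosDef →
      p ≤ logDetObj (toeplitz R + toeplitz (symmetrize Y)) X' := by
    intro X' hX' hX0'
    simpa [frob] using hlag X' 0 ⟨hX0', hX', PosSemidef.zero⟩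
  refine ⟨symmetrize Y, hZ0, ?_, hd', hc', ?_, hlagX⟩
  · exact posSemidef_of_le_logDetObj ((toeplitz_isSymm hR0).add (toeplitz_isSymm hZ0)) hlagX
  · refine posSemidef_of_frob_nonneg (slackV_isSymm lam hZ0) fun B hB => ?_
    rw [← neg_nonpos]
    refine nonpos_of_forall_mul_le
      (C := logDetObj (toeplitz R + toeplitz (symmetrize Y)) 1 - p) fun t ht => ?_
    have h1 := hlag 1 (t • B) ⟨block_one_posDef, PosSemidef.one,
      hB.posSemidef.smul (by linarith : (0 : ℝ) ≤ t)⟩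
    rw [frob_smul_right] at h1
    linarith

/-- Strong duality: the primal value is at most the dual value. -/
theorem primalObj_le_dual {R : BlockRow m n} {lam gam : ℝ} (hlam : 0 < lam) (hgam : 0 < gam)
    (hR0 : (R 0).IsSymm) (hR : (toeplitz R).PosDef)
    {X L : BlockMat m n} (hXL : IsPrimalSolution R lam gam X L)
    {W : Matrix (Fin m) (Fin m) ℝ} {Z : BlockRow m n} (hWZ : IsDualSolution R lam gam W Z) :
    primalObj R lam gam X L ≤ Real.log W.det + m := by
  obtain ⟨Z₁, hZ0, hA, hd, hc, hV, hlow⟩ := exists_multiplier hlam hgam hR0 hXL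
  -- Used only for the finite lower bound `q` on the unperturbed objective.
  obtain ⟨W₁, X₁, hW₁, hA₁, -, -, -⟩ := exists_logDetObj_eq hR
  set p := primalObj R lam gam X L
  set q := Real.log W₁.det + m with hq
  have hval : ∀ t : ℝ, 0 < t → t < 1 → (1 - t) * p + t * q ≤ Real.log W.det + m := by
    intro t ht0 ht1
    have h1t : 0 ≤ 1 - t := by linarith
    have hAt : toeplitz R + toeplitz ((1 - t) • Z₁) =
        t • toeplitz R + (1 - t) • (toeplitz R + toeplitz Z₁) := by
      rw [toeplitz_smul]
      module
    have hpd : (toeplitz R + toeplitz ((1 - t) • Z₁)).PosDef := by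
      rw [hAt]
      exact (hR.smul ht0).add_posSemidef (hA.smul h1t)
    obtain ⟨W₂, X₂, hW₂, hA₂, hX₂, hX₂0, heq⟩ := exists_logDetObj_eq hpd
    have hfeas : DualFeasible R lam gam W₂ ((1 - t) • Z₁) := by
      refine ⟨hW₂, IsSymm.smul (A := Z₁ 0) hZ0 (1 - t), hA₂, fun j k => ?_, fun k h hkh => ?_, ?_⟩
      · simp [hd]
      · have : ∑ j, (|((1 - t) • Z₁) j k h| + |((1 - t) • Z₁) j h k|) =
            (1 - t) * ∑ j, (|Z₁ j k h| + |Z₁ j h k|) := by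
          simp [abs_mul, abs_of_nonneg h1t, Finset.mul_sum, mul_add]
        rw [this]
        refine (mul_le_of_le_one_left ?_ (by linarith)).trans (hc k h hkh)
        positivity
      · have : slackV lam ((1 - t) • Z₁) =
            (t * lam) • (1 : BlockMat m n) + (1 - t) • slackV lam Z₁ := by
          rw [slackV, slackV, toeplitz_smul]
          module
        rw [this]
        exact (PosSemidef.one.smul (mul_pos ht0 hlam).le).add (hV.smul h1t)
    refine le_trans ?_ (hWZ.2 W₂ _ hfeas)
    rw [← heq, hAt]
    have h1 := hlow X₂ hX₂ hX₂0
    have h2 := (add_le_logDetObj hW₁ hA₁ hX₂ hX₂0).1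
    have h3 := frob_nonneg hA₁ hX₂
    have h4 : logDetObj (t • toeplitz R + (1 - t) • (toeplitz R + toeplitz Z₁)) X₂ =
        t * logDetObj (toeplitz R) X₂ + (1 - t) * logDetObj (toeplitz R + toeplitz Z₁) X₂ := by
      simp only [logDetObj, frob_add_left, frob_smul_left]
      ring
    rw [h4]
    have h5 := mul_le_mul_of_nonneg_left h1 h1t
    have h6 : t * q ≤ t * logDetObj (toeplitz R) X₂ :=
      mul_le_mul_of_nonneg_left (by linarith) ht0.le
    linarith
  by_contra hlt
  push Not at hlt
  set d := Real.log W.det + m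
  have hpd : 0 < p - d := by linarith
  have hden : 0 < p - d + |p - q| + 1 := by positivity
  -- Chosen so that `(1 - t) p + t q ≥ p - t |p - q| > d`.
  set t := (p - d) / (p - d + |p - q| + 1) with ht
  have ht0 : 0 < t := div_pos hpd hden
  have ht1 : t < 1 := by
    rw [ht, div_lt_one hden]
    linarith [abs_nonneg (p - q)]
  have h1 := hval t ht0 ht1
  have h2 : t * (p - d + |p - q| + 1) = p - d := div_mul_cancel₀ _ hden.ne'
  have h3 := mul_le_mul_of_nonneg_left (le_abs_self (p - q)) ht0.le
  nlinarith [mul_pos ht0 hpd]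

/-- Complementary slackness. -/
theorem complementary_slackness {R : BlockRow m n} {lam gam : ℝ} (hlam : 0 < lam) (hgam : 0 < gam)
    (hR0 : (R 0).IsSymm) (hR : (toeplitz R).PosDef)
    {X L : BlockMat m n} (hXL : IsPrimalSolution R lam gam X L)
    {W : Matrix (Fin m) (Fin m) ℝ} {Z : BlockRow m n} (hWZ : IsDualSolution R lam gam W Z) :
    block X 0 0 = W⁻¹ ∧ (toeplitz R + toeplitz Z - embed00 n W) * X = 0 ∧ slackV lam Z * L = 0 ∧
      ∀ k h, (k, h) ∈ inactivePairs lam gam Z → ∀ j, blockDiagSum (X + L) j k h = 0 := by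
  have hle := primalObj_le_dual hlam hgam hR0 hR hXL hWZ
  obtain ⟨⟨hX0, hX, hL⟩, -⟩ := hXL
  obtain ⟨⟨hW, hZ0, hA, hd, hc, hV⟩, -⟩ := hWZ
  obtain ⟨h1, h2⟩ := add_le_logDetObj hW hA hX hX0
  obtain ⟨h3, h4⟩ := pairing_le_hInf hd hc (blockDiagSum (X + L))
  have h5 := frob_nonneg hV hL
  have h6 := frob_nonneg hA hX
  -- The gap is the excess of the log-determinant term over its bound, plus `⟨V, L⟩`, plus the slack
  -- in the `h_∞` inequality. All three are nonnegative, so a zero gap kills each.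
  have h7 : primalObj R lam gam X L = logDetObj (toeplitz R + toeplitz Z) X +
      frob (slackV lam Z) L +
      (lam * gam * hInf (blockDiagSum (X + L)) - pairing Z (blockDiagSum (X + L))) := by
    rw [frob_slackV lam Z hL.isSymm_real, primalObj_eq, logDetObj, logDetObj, frob_add_left,
      frob_toeplitz Z hX.isSymm_real]
    nth_rw 3 [blockDiagSum_add]
    rw [pairing_add_right]
    ring
  obtain ⟨h8, h9⟩ := h2 (by linarith)
  exact ⟨h8, h9, mul_eq_zero_of_frob_nonpos hV hL (by linarith),
    fun k h hI => h4 (by linarith) k h hI.1 hI.2⟩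

/-! ### Uniqueness of the primal solution and the estimated subspaces. -/

theorem toeplitz_add (Y Y' : BlockRow m n) : toeplitz (Y + Y') = toeplitz Y + toeplitz Y' := by
  ext p q
  simp only [toeplitz, of_apply, Matrix.add_apply, Pi.add_apply]
  split_ifs <;> rfl

/-- With `E` the first block inclusion, slackness reads `X = A⁻¹ E W (Eᵀ X)`. Multiplying by `E` and
using `X_{00} = W⁻¹` gives `X E = A⁻¹ E`, hence `Eᵀ X` by symmetry. -/
theorem eq_of_slackness {A X : BlockMat m n} {W : Matrix (Fin m) (Fin m) ℝ} (hA : A.PosDef)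
    (hW : W.PosDef) (hX : X.IsSymm) (h0 : block X 0 0 = W⁻¹) (h1 : (A - embed00 n W) * X = 0) :
    X = A⁻¹ * firstBlock m n * W * (A⁻¹ * firstBlock m n)ᵀ := by
  set E := firstBlock m n with hE
  have h2 : X = A⁻¹ * E * W * (Eᵀ * X) := by
    rw [sub_mul, sub_eq_zero, embed00_eq, ← hE] at h1
    calc X = A⁻¹ * (A * X) := by
          rw [← Matrix.mul_assoc, nonsing_inv_mul _ hA.det_pos.ne'.isUnit, Matrix.one_mul]
      _ = _ := by rw [h1]; simp only [Matrix.mul_assoc]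
  have h3 : X * E = A⁻¹ * E := by
    have h4 : X * E = A⁻¹ * E * (W * (Eᵀ * X * E)) := by
      conv_lhs => rw [h2]
      simp only [Matrix.mul_assoc]
    rw [h4, ← block_zero_zero, h0, mul_nonsing_inv _ hW.det_pos.ne'.isUnit, Matrix.mul_one]
  have h5 : Eᵀ * X = (A⁻¹ * E)ᵀ := by rw [← h3, transpose_mul, hX.eq]
  rw [← h5]
  exact h2

/-- The orthogonal projection `Gᵀ (G Gᵀ)⁻¹ G` onto the nullspace of `V` fixes `L` on the left, and
by symmetry on the right. -/
theorem exists_eq_conj_of_mul_eq_zero {l : ℕ} {V L : BlockMat m n}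
    {G : Matrix (Fin l) (Fin (n + 1) × Fin m) ℝ} (hG : IsNullBasis V G) (hL : L.IsSymm)
    (hVL : V * L = 0) : ∃ H : Matrix (Fin l) (Fin l) ℝ, H.IsSymm ∧ L = Gᵀ * H * G := by
  obtain ⟨hl, hrank, hVG⟩ := hG
  have hu := isUnit_mul_transpose_of_rank hrank
  set K := (G * Gᵀ)⁻¹ with hK
  have hKs : Kᵀ = K := by rw [hK, transpose_nonsing_inv, transpose_mul, transpose_transpose]
  have hrange : LinearMap.range Gᵀ.mulVecLin = LinearMap.ker V.mulVecLin := by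
    refine Submodule.eq_of_le_of_finrank_eq ?_ ?_
    · rintro _ ⟨y, rfl⟩
      rw [LinearMap.mem_ker, mulVecLin_apply, mulVecLin_apply, mulVec_mulVec, hVG, zero_mulVec]
    · rw [← hl]
      exact (rank_transpose G).trans hrank
  have hproj : Gᵀ * K * G * L = L := by
    ext p q
    have hmem : L.col q ∈ LinearMap.ker V.mulVecLin := by
      rw [LinearMap.mem_ker, mulVecLin_apply]
      funext i
      exact congrFun (congrFun hVL i) q
    rw [← hrange] at hmem
    obtain ⟨y, hy⟩ := hmem
    rw [mulVecLin_apply] at hy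
    have h1 : (Gᵀ * K * G) *ᵥ L.col q = L.col q := by
      rw [← hy, mulVec_mulVec, Matrix.mul_assoc, Matrix.mul_assoc, nonsing_inv_mul _ hu,
        Matrix.mul_one]
    exact congrFun h1 p
  have hproj' : L * (Gᵀ * K * G) = L := by
    have := congrArg transpose hproj
    simpa only [transpose_mul, transpose_transpose, hKs, hL.eq, Matrix.mul_assoc] using this
  refine ⟨K * G * L * Gᵀ * K, ?_, ?_⟩
  · simp only [IsSymm, transpose_mul, transpose_transpose, hKs, hL.eq, Matrix.mul_assoc]
  · conv_lhs => rw [← hproj', ← hproj]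
    simp only [Matrix.mul_assoc]

theorem lowRankSpace_mul_le {l r : ℕ} (M : Matrix (Fin r) (Fin l) ℝ)
    (G : Matrix (Fin l) (Fin (n + 1) × Fin m) ℝ) :
    lowRankSpace (M * G) ≤ lowRankSpace G := by
  rintro _ ⟨H, hH, rfl⟩
  refine ⟨Mᵀ * H * M, ?_, ?_⟩
  · simp only [IsSymm, transpose_mul, transpose_transpose, hH.eq, Matrix.mul_assoc]
  · simp only [transpose_mul, Matrix.mul_assoc]

/-- `(G' G'ᵀ)⁻¹ G'` is a left inverse of `G'ᵀ`, so `G'` is recovered from `G'ᵀ G'` and its rows are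
combinations of those of `G`. -/
theorem eq_mul_of_transpose_mul_self_eq {l r : ℕ}
    {G' : Matrix (Fin r) (Fin (n + 1) × Fin m) ℝ} (hG' : G'.rank = r)
    {G : Matrix (Fin l) (Fin (n + 1) × Fin m) ℝ}
    {B : Matrix (Fin (n + 1) × Fin m) (Fin l) ℝ} (h : G'ᵀ * G' = B * G) :
    G' = (G' * G'ᵀ)⁻¹ * G' * B * G := by
  have hu := isUnit_mul_transpose_of_rank hG'
  calc G' = (G' * G'ᵀ)⁻¹ * (G' * G'ᵀ) * G' := by rw [nonsing_inv_mul _ hu, Matrix.one_mul]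
    _ = (G' * G'ᵀ)⁻¹ * G' * (G'ᵀ * G') := by simp only [Matrix.mul_assoc]
    _ = _ := by rw [h]; simp only [Matrix.mul_assoc]

theorem lowRankSpace_le_of_transpose_mul_self_eq {l r : ℕ}
    {G' : Matrix (Fin r) (Fin (n + 1) × Fin m) ℝ} (hG' : G'.rank = r)
    {G : Matrix (Fin l) (Fin (n + 1) × Fin m) ℝ}
    {B : Matrix (Fin (n + 1) × Fin m) (Fin l) ℝ} (h : G'ᵀ * G' = B * G) :
    lowRankSpace G' ≤ lowRankSpace G := by
  rw [eq_mul_of_transpose_mul_self_eq hG' h]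
  exact lowRankSpace_mul_le _ G

theorem isSymm_conj {l : ℕ} {G : Matrix (Fin l) (Fin (n + 1) × Fin m) ℝ}
    {H : Matrix (Fin l) (Fin l) ℝ} (hH : H.IsSymm) : (Gᵀ * H * G).IsSymm := by
  simp only [IsSymm, transpose_mul, transpose_transpose, hH.eq, Matrix.mul_assoc]

theorem inactivePairs_swap {lam gam : ℝ} {Z : BlockRow m n} {k h : Fin m}
    (hI : (k, h) ∈ inactivePairs lam gam Z) : (h, k) ∈ inactivePairs lam gam Z :=
  ⟨hI.1.symm, by simpa only [add_comm] using hI.2⟩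

theorem sparseSpace_inf_lowRankSpace {l : ℕ} {lam gam : ℝ} {X L : BlockMat m n} {Z : BlockRow m n}
    {G : Matrix (Fin l) (Fin (n + 1) × Fin m) ℝ} {H : Matrix (Fin l) (Fin l) ℝ}
    (hX : X.IsSymm) (hH : H.IsSymm) (hL : L = Gᵀ * H * G)
    (hD : ∀ k h, (k, h) ∈ inactivePairs lam gam Z → ∀ j, blockDiagSum (X + L) j k h = 0)
    (huniq : ∀ K K', SolvesScalingSystem lam gam X Z G K → SolvesScalingSystem lam gam X Z G K' →
      K = K') :
    sparseSpace n (support (symbol (X + L))) ⊓ lowRankSpace G = ⊥ := by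
  rw [eq_bot_iff]
  rintro _ ⟨⟨-, hsupp⟩, K, hK, rfl⟩
  have hL' : L.IsSymm := hL ▸ isSymm_conj hH
  have hKD : ∀ k h, (k, h) ∈ inactivePairs lam gam Z → ∀ j,
      blockDiagSum (Gᵀ * K * G) j k h = 0 := by
    intro k h hI
    -- An inactive pair is outside the support of the symbol of `X + L`, since `D(X + L)` vanishes
    -- there in both orders.
    refine blockDiagSum_eq_zero_of_symbol_eq_zero fun z => hsupp (k, h) ?_ z
    rintro ⟨z', hz'⟩
    exact hz' (symbol_eq_zero_of_blockDiagSum_eq_zero (hX.add hL') (hD k h hI)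
      (hD h k (inactivePairs_swap hI)) z')
  have h1 : SolvesScalingSystem lam gam X Z G H := ⟨hH, fun j p hp => hL ▸ hD p.1 p.2 hp j⟩
  have h2 : SolvesScalingSystem lam gam X Z G (H + K) := by
    refine ⟨hH.add hK, fun j p hp => ?_⟩
    rw [Matrix.mul_add, Matrix.add_mul, ← add_assoc, blockDiagSum_add, Pi.add_apply,
      Matrix.add_apply, ← hL, hD p.1 p.2 hp j, hKD p.1 p.2 hp j, add_zero]
  have h3 : K = 0 := by simpa using (huniq _ _ h1 h2).symm
  rw [h3, Submodule.mem_bot]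
  funext z
  simp [symbol]

end LatentAR

/-! ### Assembly of the main theorem. -/

theorem mainTheorem5 {m n l : ℕ} (R : LatentAR.BlockRow m n) (lam gam : ℝ)
    (hlam : 0 < lam) (hgam : 0 < gam)
    (hR0 : (R 0).IsSymm) (hR : (LatentAR.toeplitz R).PosDef)
    (X L : LatentAR.BlockMat m n) (hXL : LatentAR.IsPrimalSolution R lam gam X L)
    (W : Matrix (Fin m) (Fin m) ℝ) (Z : LatentAR.BlockRow m n)
    (hWZ : LatentAR.IsDualSolution R lam gam W Z)
    (G : Matrix (Fin l) (Fin (n + 1) × Fin m) ℝ)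
    (hG : LatentAR.IsNullBasis (LatentAR.slackV lam Z) G)
    (hH : ∃! H : Matrix (Fin l) (Fin l) ℝ, LatentAR.SolvesScalingSystem lam gam X Z G H) :
    ∃ VE VG : Submodule ℝ (LatentAR.CircleFun m),
      LatentAR.IsEstimatedPair R lam gam VE VG ∧
      (∀ VE' VG' : Submodule ℝ (LatentAR.CircleFun m),
        LatentAR.IsEstimatedPair R lam gam VE' VG' → VE' = VE ∧ VG' = VG) ∧
      VE ⊓ VG = ⊥ ∧
      VE ⊓ LatentAR.lowRankSpace G = ⊥ := by
  open LatentAR in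
  have hA : (toeplitz R + toeplitz Z).PosDef := by
    have h := hWZ.1.2.2.1
    rw [← toeplitz_add] at h ⊢
    exact toeplitz_posDef hWZ.1.1 h
  -- The dual solution is fixed while the primal one varies, so all primal solutions obey the same
  -- equations.
  have hslack := fun {X' L'} (h : IsPrimalSolution R lam gam X' L') =>
    complementary_slackness hlam hgam hR0 hR h hWZ
  have hsymmX := hXL.1.2.1.isSymm_real
  have hscale : ∀ {X' L'}, IsPrimalSolution R lam gam X' L' → X' = X ∧
      ∃ H, SolvesScalingSystem lam gam X Z G H ∧ L' = Gᵀ * H * G := by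
    intro X' L' h
    have hX' : X' = X := by
      obtain ⟨h1, h2, -, -⟩ := hslack hXL
      obtain ⟨h1', h2', -, -⟩ := hslack h
      rw [eq_of_slackness hA hWZ.1.1 hsymmX h1 h2,
        eq_of_slackness hA hWZ.1.1 h.1.2.1.isSymm_real h1' h2']
    obtain ⟨-, -, h3, h4⟩ := hslack h
    obtain ⟨H, hHs, hHL⟩ := exists_eq_conj_of_mul_eq_zero hG h.1.2.2.isSymm_real h3
    subst hX'
    exact ⟨rfl, H, ⟨hHs, fun j p hp => hHL ▸ h4 p.1 p.2 hp j⟩, hHL⟩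
  obtain ⟨-, H, hHsol, hHL⟩ := hscale hXL
  have hunique : ∀ {X' L'}, IsPrimalSolution R lam gam X' L' → X' = X ∧ L' = L := by
    intro X' L' h
    obtain ⟨hX', H', hH', hL'⟩ := hscale h
    exact ⟨hX', by rw [hL', hHL, hH.unique hH' hHsol]⟩
  obtain ⟨r, G', hLG', hrank⟩ := exists_full_rank_factor hXL.1.2.2
  have hGtrans : sparseSpace n (support (symbol (X + L))) ⊓ lowRankSpace G = ⊥ :=
    sparseSpace_inf_lowRankSpace hsymmX hHsol.1 hHL (hslack hXL).2.2.2 fun _ _ => hH.unique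
  refine ⟨sparseSpace n (support (symbol (X + L))), lowRankSpace G',
    ⟨X, L, r, G', hXL, hLG', hrank, rfl, rfl⟩, ?_, ?_, hGtrans⟩
  · rintro VE' VG' ⟨X', L', r', G'', hsol, hLG'', hrank', rfl, rfl⟩
    obtain ⟨rfl, rfl⟩ := hunique hsol
    exact ⟨rfl, le_antisymm
      (lowRankSpace_le_of_transpose_mul_self_eq hrank' (hLG''.symm.trans hLG'))
      (lowRankSpace_le_of_transpose_mul_self_eq hrank (hLG'.symm.trans hLG''))⟩
  · refine le_bot_iff.mp (le_trans (inf_le_inf_left _ ?_) hGtrans.le)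
    exact lowRankSpace_le_of_transpose_mul_self_eq hrank (hLG'.symm.trans hHL)
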